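/- Let $\ell, m, n$ be positive integers. All manifolds (Hausdorff, second countable, without boundary) and all mappings are of class $C^\infty$. Let $N$ be a manifold of dimension $n$, and let $A=(a_{ij})_{1\le i\le \ell,\,1\le j\le m}$ be a real $\ell\times m$ matrix with all entries non-zero. For $p=(p_1,\dots,p_\ell)\in(\mathbb{R}^m)^\ell$, $p_i=(p_{i1},\dots,p_{im})$, let $G_{(p,A)}:\mathbb{R}^m\to\mathbb{R}^\ell$ be the generalized distance-squared mapping $$G_{(p,A)}(x)=\Bigl(\sum_{j=1}^m a_{1j}(x_j-p_{1j})^2,\ \dots,\ \sum_{j=1}^m a_{\ell j}(x_j-p_{\ell j})^2\Bigr).$$ A mapping $g:M\to P$ of manifolds is transverse to a submanifold $W\subset P$ if $dg_q(T_qM)+T_{g(q)}W=T_{g(q)}P$ for every $q\in M$ with $g(q)\in W$. (1) Let $J^1(n,\ell)$ be the space of $1$-jets at $0$ of map germs $(\mathbb{R}^n,0)\to(\mathbb{R}^\ell,0)$, and let $X\subset J^1(n,\ell)$ be a submanifold that is $\mathcal{A}^1$-invariant: if $j^1g(0)\in X$, then $j^1(H\circ g\circ h^{-1})(0)\in X$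 for all germs of diffeomorphisms $H$ of $(\mathbb{R}^\ell,0)$ and $h$ of $(\mathbb{R}^n,0)$. Let $X(N,\mathbb{R}^\ell)$ be the subfiber-bundle of the jet bundle $J^1(N,\mathbb{R}^\ell)$ with fiber $X$, that is, the set of jets $j^1g(q)$ whose expression in a chart $\varphi$ of $N$ around $q$, namely the $1$-jet at $0$ of $t\mapsto g(\varphi^{-1}(\varphi(q)+t))-g(q)$, lies in $X$. If $f:N\to\mathbb{R}^m$ is an immersion, then there is a set $\Sigma\subset(\mathbb{R}^m)^\ell$ of Lebesgue measure zero such that for every $p\in(\mathbb{R}^m)^\ell\setminus\Sigma$ the mapping $j^1(G_{(p,A)}\circ f):N\to J^1(N,\mathbb{R}^\ell)$ is transverse to $X(N,\mathbb{R}^\ell)$. (2) For a positive integer $s$ let $N^{(s)}=\{(q_1,\dots,q_s)\in N^s\mid q_i\ne q_j\ (i\ne j)\}$, an open submanifold of $N^s$; for $g:N\to\mathbb{R}^\ell$ let $g^{(s)}:N^{(s)}\to(\mathbb{R}^\ell)^s$, $g^{(s)}(q_1,\dots,q_s)=(g(q_1),\dots,g(q_s))$; and let $\Delta_s=\{(y,\dots,y)\mid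 y\in\mathbb{R}^\ell\}\subset(\mathbb{R}^\ell)^s$. The mapping $g$ is a mapping with normal crossings if $g^{(s)}$ is transverse to $\Delta_s$ for every integer $s\ge 2$. If $f:N\to\mathbb{R}^m$ is an injective ($C^\infty$) mapping and $$s_f=\max\Bigl\{s\ \Big|\ \forall (q_1,\dots,q_s)\in N^{(s)},\ \dim\sum_{i=2}^s\mathbb{R}\,\overrightarrow{f(q_1)f(q_i)}=s-1\Bigr\},$$ then there is a set $\Sigma\subset(\mathbb{R}^m)^\ell$ of Lebesgue measure zero such that for every $p\in(\mathbb{R}^m)^\ell\setminus\Sigma$ the following hold: for every integer $s$ with $2\le s\le s_f$ the mapping $(G_{(p,A)}\circ f)^{(s)}:N^{(s)}\to(\mathbb{R}^\ell)^s$ is transverse to $\Delta_s$; moreover, if $|G_{(p,A)}^{-1}(y)|\le s_f$ for every $y\in\mathbb{R}^\ell$, then $G_{(p,A)}\circ f:N\to\mathbb{R}^\ell$ is a mapping with normal crossings. -/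

import Mathlib

open Set Bundle MeasureTheory Topology
open scoped Manifold ContDiff

noncomputable section

/-! ### Transversality -/

section Transversality

variable {E H M E' H' P : Type*}
  [NormedAddCommGroup E] [NormedSpace ℝ E] [TopologicalSpace H] [TopologicalSpace M]
  [ChartedSpace H M]
  [NormedAddCommGroup E'] [NormedSpace ℝ E'] [TopologicalSpace H'] [TopologicalSpace P]
  [ChartedSpace H' P]

/-- The tangent space `T_y W ⊆ T_y P` of a subset `W` of a manifold `P` at `y`: the span of the
velocities at time `0` of the smooth curves through `y` that stay in `W`. When `W` is a
submanifold, the velocities already form a subspace, the usual tangent space. -/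
def tangentSpaceOf (J : ModelWithCorners ℝ E' H') (W : Set P) (y : P) :
    Submodule ℝ (TangentSpace J y) :=
  Submodule.span ℝ {v | ∃ γ : ℝ → P, γ 0 = y ∧
    (∀ᶠ t in 𝓝 (0 : ℝ), ContMDiffAt 𝓘(ℝ, ℝ) J ∞ γ t ∧ γ t ∈ W) ∧
    (mfderiv 𝓘(ℝ, ℝ) J γ 0 (1 : ℝ) : E') = v}

/-- `g` is transverse to `W` at `q`: either `g q ∉ W`, or `dg_q(T_q M) + T_{g q} W = T_{g q} P`. -/
def IsTransverseAt (I : ModelWithCorners ℝ E H) (J : ModelWithCorners ℝ E' H')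
    (g : M → P) (W : Set P) (q : M) : Prop :=
  g q ∈ W → (mfderiv I J g q).range ⊔ tangentSpaceOf J W (g q) = ⊤

/-- `g` is transverse to `W`: it is so at every point. -/
def IsTransverse (I : ModelWithCorners ℝ E H) (J : ModelWithCorners ℝ E' H')
    (g : M → P) (W : Set P) : Prop :=
  ∀ q : M, IsTransverseAt I J g W q

/-- A smooth immersion: a smooth map whose differential is injective at every point. -/
def IsSmoothImmersion (I : ModelWithCorners ℝ E H) (J : ModelWithCorners ℝ E' H')
    (g : M → P) : Prop :=
  ContMDiff I J ∞ g ∧ ∀ q : M, Function.Injective (mfderiv I J g q)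

end Transversality

/-- A (regular, smooth, boundaryless) submanifold of a finite-dimensional real vector space `V`:
for some `d`, around each point of `S` there is a diffeomorphism `φ` between open subsets of `V`
that carries `S` to a `d`-dimensional linear subspace. -/
def IsSubmanifold {V : Type*} [NormedAddCommGroup V] [NormedSpace ℝ V] (S : Set V) : Prop :=
  ∃ d : ℕ, ∀ x ∈ S, ∃ (φ : OpenPartialHomeomorph V V) (L : Submodule ℝ V),
    x ∈ φ.source ∧ ContDiffOn ℝ ∞ φ φ.source ∧ ContDiffOn ℝ ∞ φ.symm φ.target ∧
    Module.finrank ℝ L = d ∧ ∀ y ∈ φ.source, y ∈ S ↔ φ y ∈ L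

/-- Euclidean space `ℝ^k`. -/
abbrev Euc (k : ℕ) : Type := EuclideanSpace ℝ (Fin k)

/-! ### 1-jets -/

/-- `J^1(n, ℓ)`, the space of 1-jets at `0` of maps `(ℝ^n, 0) → (ℝ^ℓ, 0)`; the jet `j^1 g (0)` is
identified with the derivative of `g` at `0`. -/
abbrev JetFiber (n ℓ : ℕ) : Type := Euc n →L[ℝ] Euc ℓ

/-- A germ of diffeomorphism `(ℝ^k, 0) → (ℝ^k, 0)`, given by a representative defined between two
open neighbourhoods of `0`. -/
def IsDiffeoGermAtZero {k : ℕ} (h : OpenPartialHomeomorph (Euc k) (Euc k)) : Prop :=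
  0 ∈ h.source ∧ h 0 = 0 ∧ ContDiffOn ℝ ∞ h h.source ∧ ContDiffOn ℝ ∞ h.symm h.target

/-- `X ⊆ J^1(n, ℓ)` is `𝒜^1`-invariant: for every smooth map germ `g : (ℝ^n, 0) → (ℝ^ℓ, 0)` with
`j^1 g (0) ∈ X` and all germs of diffeomorphisms `T` of `(ℝ^ℓ, 0)` and `h` of `(ℝ^n, 0)`, also
`j^1 (T ∘ g ∘ h⁻¹) (0) ∈ X`. -/
def IsA1Invariant {n ℓ : ℕ} (X : Set (JetFiber n ℓ)) : Prop :=
  ∀ g : Euc n → Euc ℓ, (∀ᶠ x in 𝓝 (0 : Euc n), ContDiffAt ℝ ∞ g x) → g 0 = 0 →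
    fderiv ℝ g 0 ∈ X →
    ∀ (T : OpenPartialHomeomorph (Euc ℓ) (Euc ℓ)) (h : OpenPartialHomeomorph (Euc n) (Euc n)),
      IsDiffeoGermAtZero T → IsDiffeoGermAtZero h →
      fderiv ℝ (fun x => T (g (h.symm x))) 0 ∈ X

section JetBundle

variable (n ℓ : ℕ) (N : Type*) [TopologicalSpace N] [ChartedSpace (Euc n) N]

/-- The 1-jet bundle `J^1(N, ℝ^ℓ)`: a 1-jet consists of its source `q ∈ N`, a linear map
`T_q N → ℝ^ℓ` (the first derivative), and its target `y ∈ ℝ^ℓ`. As a manifold it is the product of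
the total space of the smooth vector bundle `Hom(TN, ℝ^ℓ)` over `N` with `ℝ^ℓ`; the chart of it
induced by a chart `φ` of `N` is `(q, L, y) ↦ (φ q, L ∘ d(φ⁻¹)_{φ q}, y)`. -/
abbrev JetBundle : Type _ :=
  TotalSpace (JetFiber n ℓ)
    (fun q : N => TangentSpace (𝓡 n) q →L[ℝ] Bundle.Trivial N (Euc ℓ) q) × Euc ℓ

/-- The model with corners of the manifold `J^1(N, ℝ^ℓ)`. -/
abbrev jetModel : ModelWithCorners ℝ ((Euc n × JetFiber n ℓ) × Euc ℓ)
    (ModelProd (ModelProd (Euc n) (JetFiber n ℓ)) (Euc ℓ)) :=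
  ((𝓡 n).prod 𝓘(ℝ, JetFiber n ℓ)).prod 𝓘(ℝ, Euc ℓ)

variable {n ℓ N}

/-- The source `q ∈ N` of a 1-jet. -/
def JetBundle.source (z : JetBundle n ℓ N) : N := z.1.proj

/-- The derivative `T_q N → ℝ^ℓ` of a 1-jet with source `q`. -/
def JetBundle.derivative (z : JetBundle n ℓ N) :
    TangentSpace (𝓡 n) (JetBundle.source z) →L[ℝ] Euc ℓ :=
  z.1.snd

/-- The 1-jet extension `j^1 g : N → J^1(N, ℝ^ℓ)`, `q ↦ (q, dg_q, g q)`. -/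
def jet1 (g : N → Euc ℓ) (q : N) : JetBundle n ℓ N :=
  (⟨q, mfderiv (𝓡 n) 𝓘(ℝ, Euc ℓ) g q⟩, g q)

/-- The expression in `J^1(n, ℓ)` of a jet `z` over `q` in a chart `φ` around `q`: if `z = j^1 g (q)`
then it is the derivative of `g ∘ φ⁻¹` at `φ q`, that is, `dg_q ∘ d(φ⁻¹)_{φ q}`. -/
def jetInChart (φ : OpenPartialHomeomorph N (Euc n)) (z : JetBundle n ℓ N) : JetFiber n ℓ :=
  ContinuousLinearMap.comp (JetBundle.derivative z : Euc n →L[ℝ] Euc ℓ)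
    (mfderiv (𝓡 n) (𝓡 n) φ.symm (φ (JetBundle.source z)) : Euc n →L[ℝ] Euc n)

/-- The subfibre-bundle `X(N, ℝ^ℓ)` of `J^1(N, ℝ^ℓ)` with fibre `X`: the jets whose expression in
some chart of the atlas of `N` around the source of the jet lies in `X`. -/
def jetSubbundle (X : Set (JetFiber n ℓ)) : Set (JetBundle n ℓ N) :=
  {z | ∃ φ ∈ atlas (Euc n) N, JetBundle.source z ∈ φ.source ∧ jetInChart φ z ∈ X}

end JetBundle

/-! ### Multiple points -/

/-- `N^{(s)}`, the open submanifold of `N^s` of the `s`-tuples of pairwise distinct points. -/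
def distinctTuples (N : Type*) [TopologicalSpace N] [T2Space N] (s : ℕ) :
    TopologicalSpace.Opens (Fin s → N) where
  carrier := {q | ∀ i j, i ≠ j → q i ≠ q j}
  is_open' := by
    simp only [ofPred_forall]
    exact isOpen_iInter_of_finite fun i => isOpen_iInter_of_finite fun j =>
      isOpen_iInter_of_finite fun _ => isOpen_ne_fun (continuous_apply i) (continuous_apply j)

/-- `g^{(s)} : N^{(s)} → P^s`, `(q_1, …, q_s) ↦ (g q_1, …, g q_s)`. -/
def multiMap {N P : Type*} [TopologicalSpace N] [T2Space N] (s : ℕ) (g : N → P)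
    (q : distinctTuples N s) : Fin s → P :=
  fun i => g (q.1 i)

/-- The diagonal `Δ_s = {(y, …, y)} ⊆ P^s`. -/
def diagonalSet (P : Type*) (s : ℕ) : Set (Fin s → P) :=
  range fun (y : P) (_ : Fin s) => y

/-- `g^{(s)} : N^{(s)} → (ℝ^ℓ)^s` is transverse to `Δ_s`. -/
def MultiTransverse {n ℓ : ℕ} {N : Type*} [TopologicalSpace N] [T2Space N]
    [ChartedSpace (Euc n) N] (g : N → Euc ℓ) (s : ℕ) : Prop :=
  IsTransverse (ModelWithCorners.pi fun _ : Fin s => 𝓡 n) 𝓘(ℝ, Fin s → Euc ℓ)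
    (multiMap s g) (diagonalSet (Euc ℓ) s)

/-- `g : N → ℝ^ℓ` is a mapping with normal crossings. -/
def HasNormalCrossings {n ℓ : ℕ} {N : Type*} [TopologicalSpace N] [T2Space N]
    [ChartedSpace (Euc n) N] (g : N → Euc ℓ) : Prop :=
  ∀ s : ℕ, 2 ≤ s → MultiTransverse (n := n) g s

/-- The positive integers `s` such that for all `(q_1, …, q_s) ∈ N^{(s)}` the vectors from `f q_1`
to `f q_2, …, f q_s` span a space of dimension `s - 1`. (The zero vector from `f q_1` to itself,
which does not change the span, is included.) -/
def generalPositionNumbers {N : Type*} {m : ℕ} (f : N → Euc m) : Set ℕ :=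
  {s | ∃ hs : 0 < s, ∀ q : Fin s → N, (∀ i j, i ≠ j → q i ≠ q j) →
    Module.finrank ℝ (Submodule.span ℝ (range fun i => f (q i) - f (q ⟨0, hs⟩))) = s - 1}

/-- `s_f`, the largest element of `generalPositionNumbers f`. (This set is bounded by `m + 1` as
soon as `N` is infinite.) -/
def maxGeneralPosition {N : Type*} {m : ℕ} (f : N → Euc m) : ℕ :=
  sSup (generalPositionNumbers f)

/-! ### Generalized distance-squared mappings -/

/-- `G_{(p, A)} : ℝ^m → ℝ^ℓ`, whose `i`-th component is `∑ j, a_{ij} (x_j - p_{ij})^2`. -/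
def genDistSq {m ℓ : ℕ} (p : Fin ℓ → Euc m) (A : Matrix (Fin ℓ) (Fin m) ℝ) (x : Euc m) : Euc ℓ :=
  WithLp.toLp 2 fun i => ∑ j, A i j * (x j - p i j) ^ 2

end

/-!
Both parts say that, for almost every `p`, a map built from `G_p ∘ f` is transverse to something.
A failure of transversality at a point is witnessed by a nonzero covector `μ` that annihilates both
the image of the differential and the tangent space of the target set. As with Lagrange multipliers,
pairing `μ` with a vector that vanishes when the point is mapped into the target set gives a real
function of the point and of `μ` (and, for jets, of an auxiliary projection) which, together with its
differential, vanishes at the witness. In both parts this function is *affine* in `p`, because the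
terms of `G_p` that are quadratic in `p` disappear on taking derivatives or differences.

For a function `a x + b x p` that is affine in `p`, zero is a regular value on the set `b ≠ 0` for
almost every `p` (`ae_fderiv_affine_family_ne_zero`). Indeed, if `b x r ≠ 0` then, along the line
`p + t r`, the exceptional `t` are critical values of the function `-(a + b p) / b r`; so the
statement reduces, by Fubini along lines, to Sard's theorem for real-valued functions
(`volume_image_critical_eq_zero`). The latter is proved by induction on the dimension: where all
derivatives up to the order of the dimension vanish, the function is Hölder with an exponent greater
than the dimension; the other critical points lie on countably many pieces of smooth hypersurfaces,
where they are critical for the restricted function.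

*Jets.* An invariant set `X` of linear maps is a union of orbits of `GL(ℓ) × GL(n)`, and a jet lies
in `X(N, ℝ^ℓ)` if and only if its expression in any one chart lies in `X`. The tangent space of
`X(N, ℝ^ℓ)` therefore contains all horizontal and target directions and all `P L + L Q`
(`mem_tangentSpaceOf_jetSubbundle`), so that transversality to the orbits is enough. If this fails,
duality for the trace pairing yields `C ≠ 0` with `L C = 0` and `C L = 0` that annihilates the second
derivative of `G_p ∘ f`. With `ρ` the orthogonal projection to the complement of the range of `L`, one
has `C = C ρ` and `ρ L = 0`; hence `tr (L κ ρ)`, as a function of the point, of `κ` and of `ρ`, has a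
critical zero at `κ = C` and this `ρ`. The coefficients of `p` in it do not all vanish, since `df` is
injective and the entries of `A` are nonzero (`ae_orbitTransverseAt_genDistSq_comp`).

*Multiple points.* A covector that annihilates the diagonal is a family `(-∑ μ_i, μ_1, …, μ_k)`, and
the function is `∑ ⟪μ_i, g (y_i) - g (y_0)⟫` with `g = G_p ∘ f`. The coefficients of `p` in it are
multiples of the coordinates of the vectors `∑ μ_{i,l} (f (y_i) - f (y_0))`, which do not all vanish
when the points `f (y_i)` are in general position, that is, for tuples of at most `s_f` points
(`ae_covector_eq_zero`). If the fibres of `G_p` have at most `s_f` points, injectivity of `f` prevents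
longer tuples from being mapped to the diagonal (`multiTransverse_of_encard_le`).
-/

/-! ### Critical values of smooth functions -/

theorem volume_image_null_of_locally_null {X : Type*} [TopologicalSpace X]
    [SecondCountableTopology X] {f : X → ℝ} {s : Set X}
    (h : ∀ x ∈ s, ∃ u ∈ 𝓝[s] x, volume (f '' u) = 0) : volume (f '' s) = 0 := by
  have := measure_null_of_locally_null (μ := OuterMeasure.comap f (volume : Measure ℝ).toOuterMeasure) s
    (by simpa [OuterMeasure.comap_apply] using h)
  simpa [OuterMeasure.comap_apply] using this

section Flat

variable {E G : Type*} [NormedAddCommGroup E] [NormedSpace ℝ E]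
  [NormedAddCommGroup G] [NormedSpace ℝ G]

/-- A function whose derivatives of orders `1, …, k` vanish at `y` varies near `y` like the power
`k + 1` of the distance to `y`. -/
theorem norm_sub_le_of_iteratedFDeriv_eq_zero {f : E → G} {s : Set E} (hs : Convex ℝ s)
    (hf : ∀ x ∈ s, ContDiffAt ℝ ∞ f x) {k : ℕ} {M : ℝ}
    (hM : ∀ x ∈ s, ‖iteratedFDeriv ℝ (k + 1) f x‖ ≤ M) {y : E} (hy : y ∈ s)
    (hzero : ∀ i, 1 ≤ i → i ≤ k → iteratedFDeriv ℝ i f y = 0) {x : E} (hx : x ∈ s) :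
    ‖f x - f y‖ ≤ M * ‖x - y‖ ^ (k + 1) := by
  have hM0 : 0 ≤ M := (norm_nonneg _).trans (hM y hy)
  have key : ∀ j i : ℕ, i + (j + 1) = k + 1 → ∀ x ∈ s,
      ‖iteratedFDeriv ℝ i f x - iteratedFDeriv ℝ i f y‖ ≤ M * ‖x - y‖ ^ (j + 1) := by
    intro j
    induction j with
    | zero =>
      intro i hi x hx
      obtain rfl : i = k := by omega
      have := hs.norm_image_sub_le_of_norm_fderiv_le (𝕜 := ℝ) (f := iteratedFDeriv ℝ i f) (C := M)
        (fun z hz => ((hf z hz).iteratedFDeriv_right (m := 1) (by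
          exact_mod_cast le_top)).differentiableAt one_ne_zero)
        (fun z hz => by rw [norm_fderiv_iteratedFDeriv]; exact hM z hz) hy hx
      simpa using this
    | succ j ih =>
      intro i hi x hx
      have hconv : Convex ℝ (s ∩ Metric.closedBall y ‖x - y‖) :=
        hs.inter (convex_closedBall _ _)
      have hyi : iteratedFDeriv ℝ (i + 1) f y = 0 := hzero _ (by omega) (by omega)
      have := hconv.norm_image_sub_le_of_norm_fderiv_le (𝕜 := ℝ) (f := iteratedFDeriv ℝ i f)
        (C := M * ‖x - y‖ ^ (j + 1)) (x := y) (y := x)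
        (fun z hz => ((hf z hz.1).iteratedFDeriv_right (m := 1) (by
          exact_mod_cast le_top)).differentiableAt one_ne_zero)
        (fun z hz => by
          rw [norm_fderiv_iteratedFDeriv]
          have h1 := ih (i + 1) (by omega) z hz.1
          rw [hyi, sub_zero] at h1
          refine h1.trans ?_
          have : ‖z - y‖ ≤ ‖x - y‖ := by simpa [dist_eq_norm] using hz.2
          gcongr)
        ⟨hy, by simp⟩ ⟨hx, by simp [dist_eq_norm]⟩
      rw [pow_succ, ← mul_assoc]
      exact this
  have h0 := key k 0 (by omega) x hx
  have e : ∀ z, iteratedFDeriv ℝ 0 f z = (continuousMultilinearCurryFin0 ℝ E G).symm (f z) := by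
    intro z; rfl
  rw [e, e, ← map_sub, LinearIsometryEquiv.norm_map] at h0
  exact h0

/-- The values of a smooth function at the points where its derivatives of orders
`1, …, dim E` vanish form a null set: the function is Hölder there with exponent greater than the
dimension. -/
theorem volume_image_flat_eq_zero [FiniteDimensional ℝ E] {f : E → ℝ} {O : Set E} (hO : IsOpen O)
    (hf : ContDiffOn ℝ ∞ f O) :
    volume (f '' {x | x ∈ O ∧ ∀ i, 1 ≤ i → i ≤ Module.finrank ℝ E →
      iteratedFDeriv ℝ i f x = 0}) = 0 := by
  set n := Module.finrank ℝ E
  have : ProperSpace E := FiniteDimensional.proper ℝ E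
  refine volume_image_null_of_locally_null fun x₀ hx₀ => ?_
  obtain ⟨r, hr, hrO⟩ := Metric.nhds_basis_closedBall.mem_iff.1 (hO.mem_nhds hx₀.1)
  have hfat : ∀ x ∈ O, ContDiffAt ℝ ∞ f x := fun x hx => hf.contDiffAt (hO.mem_nhds hx)
  have hcont : ContinuousOn (fun x => iteratedFDeriv ℝ (n + 1) f x) (Metric.closedBall x₀ r) :=
    fun x hx => ((hfat x (hrO hx)).iteratedFDeriv_right (m := 0) (by
      exact_mod_cast le_top)).continuousAt.continuousWithinAt
  obtain ⟨M, hM⟩ := (isCompact_closedBall x₀ r).exists_bound_of_continuousOn hcont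
  refine ⟨_, Filter.inter_mem self_mem_nhdsWithin
    (mem_nhdsWithin_of_mem_nhds (Metric.closedBall_mem_nhds x₀ hr)), ?_⟩
  set S := {x | x ∈ O ∧ ∀ i, 1 ≤ i → i ≤ n → iteratedFDeriv ℝ i f x = 0} ∩ Metric.closedBall x₀ r
  have hold : HolderOnWith M.toNNReal ((n + 1 : ℕ) : NNReal) f S := by
    intro x hx y hy
    have h := norm_sub_le_of_iteratedFDeriv_eq_zero (convex_closedBall x₀ r)
      (fun z hz => hfat z (hrO hz)) hM hy.2 hy.1.2 hx.2
    rw [← dist_eq_norm, ← dist_eq_norm] at h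
    rw [edist_dist, edist_dist]
    simp only [NNReal.coe_natCast, ENNReal.rpow_natCast]
    rw [← ENNReal.ofReal_pow dist_nonneg]
    refine (ENNReal.ofReal_le_ofReal h).trans ?_
    rw [ENNReal.ofReal_mul' (by positivity)]
    rfl
  have hdim : dimH (f '' S) < 1 := by
    refine (hold.dimH_image_le (by positivity)).trans_lt ?_
    have hle : dimH S ≤ n := (dimH_mono (subset_univ S)).trans_eq (Real.dimH_univ_eq_finrank E)
    rw [ENNReal.div_lt_iff (by simp) (by simp)]
    refine hle.trans_lt ?_
    rw [one_mul]
    exact_mod_cast Nat.lt_succ_self n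
  have := hausdorffMeasure_of_dimH_lt (d := 1) (by simpa using hdim)
  simpa [hausdorffMeasure_real] using this

end Flat

universe u

/-- If the critical values of smooth functions in dimension `d` are negligible, then so are, in
dimension `d + 1`, the critical values taken near a point of a smooth hypersurface `w = 0` at
critical points on this hypersurface: they are critical values of the restriction to it. -/
theorem exists_nhds_volume_image_hypersurface_eq_zero {d : ℕ}
    (ih : ∀ {K : Type u} [NormedAddCommGroup K] [NormedSpace ℝ K] [FiniteDimensional ℝ K],
      Module.finrank ℝ K = d → ∀ {f : K → ℝ} {O : Set K}, IsOpen O → ContDiffOn ℝ ∞ f O →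
        volume (f '' {x | x ∈ O ∧ fderiv ℝ f x = 0}) = 0)
    {E : Type u} [NormedAddCommGroup E] [NormedSpace ℝ E] [FiniteDimensional ℝ E]
    (hE : Module.finrank ℝ E = d + 1) {f w : E → ℝ} {O : Set E} (hO : IsOpen O)
    (hf : ContDiffOn ℝ ∞ f O) (hw : ContDiffOn ℝ ∞ w O) {x₀ : E} (hx₀ : x₀ ∈ O)
    (hdw : fderiv ℝ w x₀ ≠ 0) :
    ∃ V ∈ 𝓝 x₀, volume (f '' {x | x ∈ V ∧ w x = 0 ∧ fderiv ℝ f x = 0}) = 0 := by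
  have : CompleteSpace E := FiniteDimensional.complete ℝ E
  set l := fderiv ℝ w x₀
  have hsurj : Function.Surjective l := by
    obtain ⟨v, hv⟩ : ∃ v, l v ≠ 0 := by
      by_contra! h
      exact hdw (ContinuousLinearMap.ext h)
    intro c
    exact ⟨(c / l v) • v, by simp [hv]⟩
  obtain ⟨pr, hpr⟩ := l.ker_closedComplemented_of_finiteDimensional_range
  have hK : Module.finrank ℝ l.ker = d := by
    have h1 := LinearMap.finrank_range_add_finrank_ker (l : E →ₗ[ℝ] ℝ)
    rw [LinearMap.range_eq_top.2 hsurj, finrank_top, Module.finrank_self, hE] at h1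
    have h2 : Module.finrank ℝ l.ker = Module.finrank ℝ (LinearMap.ker (l : E →ₗ[ℝ] ℝ)) := rfl
    omega
  -- `Ψ = (w, pr)` is a local diffeomorphism that flattens the hypersurface
  set Ψ : E → ℝ × l.ker := fun x => (w x, pr x)
  have hΨ : ∀ x ∈ O, ContDiffAt ℝ ∞ Ψ x := fun x hx =>
    (hw.contDiffAt (hO.mem_nhds hx)).prodMk pr.contDiff.contDiffAt
  have hΨ' : HasFDerivAt Ψ (l.prod pr) x₀ :=
    (((hw.contDiffAt (hO.mem_nhds hx₀)).differentiableAt (by simp)).hasFDerivAt).prodMk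
      pr.hasFDerivAt
  have hinj : Function.Injective (l.prod pr) := by
    rw [injective_iff_map_eq_zero]
    intro v hv
    have h1 : l v = 0 := congrArg Prod.fst hv
    have h2 : pr v = 0 := congrArg Prod.snd hv
    have h3 := hpr ⟨v, h1⟩
    rw [h2] at h3
    exact (congrArg Subtype.val h3).symm
  have hrank : Module.finrank ℝ E = Module.finrank ℝ (ℝ × l.ker) := by
    rw [Module.finrank_prod, hK, hE, Module.finrank_self, add_comm]
  set L : E ≃L[ℝ] (ℝ × l.ker) :=
    (LinearEquiv.ofInjectiveOfFinrankEq ((l.prod pr : E →L[ℝ] ℝ × l.ker) : E →ₗ[ℝ] ℝ × l.ker)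
      hinj hrank).toContinuousLinearEquiv
  have hL : (L : E →L[ℝ] ℝ × l.ker) = l.prod pr := by ext v <;> rfl
  have hΨL : HasFDerivAt Ψ (L : E →L[ℝ] ℝ × l.ker) x₀ := hL ▸ hΨ'
  set e := (hΨ x₀ hx₀).toOpenPartialHomeomorph Ψ hΨL (by simp)
  have he₀ : x₀ ∈ e.source := (hΨ x₀ hx₀).mem_toOpenPartialHomeomorph_source hΨL (by simp)
  have hinv : ∀ᶠ x in 𝓝 x₀, fderiv ℝ Ψ x ∈ range ((↑) : (E ≃L[ℝ] ℝ × l.ker) → E →L[ℝ] ℝ × l.ker) := by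
    have hc : ContinuousAt (fderiv ℝ Ψ) x₀ :=
      ((hΨ x₀ hx₀).fderiv_right (m := 0) (by simp)).continuousAt
    refine hc.eventually_mem ?_
    rw [hΨL.fderiv]
    exact ContinuousLinearEquiv.nhds L
  obtain ⟨V, hVsub, hVo, hV₀⟩ := mem_nhds_iff.1 (Filter.inter_mem hinv (hO.mem_nhds hx₀))
  set e' := e.restrOpen V hVo
  have hsrc : e'.source = e.source ∩ V := rfl
  have hsymm : ∀ z ∈ e'.target, ContDiffAt ℝ ∞ e'.symm z := by
    intro z hz
    have hz' : e'.symm z ∈ V := (hsrc ▸ e'.map_target hz : _ ∈ e.source ∩ V).2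
    obtain ⟨L', hL'⟩ := (hVsub hz').1
    refine e'.contDiffAt_symm (f₀' := L') hz ?_ (hΨ _ (hVsub hz').2)
    rw [hL']
    exact ((hΨ _ (hVsub hz').2).differentiableAt (by simp)).hasFDerivAt
  refine ⟨e'.source, e'.open_source.mem_nhds ⟨he₀, hV₀⟩, ?_⟩
  set ι : l.ker → ℝ × l.ker := fun z => (0, z)
  have hι : ContDiff ℝ ∞ ι := contDiff_const.prodMk contDiff_id
  set T : Set l.ker := ι ⁻¹' e'.target
  have hT : IsOpen T := e'.open_target.preimage hι.continuous
  have hfat : ∀ x ∈ e'.source, ContDiffAt ℝ ∞ f x := fun x hx =>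
    hf.contDiffAt (hO.mem_nhds (hVsub (hsrc ▸ hx : _ ∈ e.source ∩ V).2).2)
  have hg : ∀ z ∈ T, ContDiffAt ℝ ∞ (fun z => e'.symm (ι z)) z := fun z hz =>
    (hsymm _ hz).comp z hι.contDiffAt
  have hnull := ih hK (f := fun z => f (e'.symm (ι z))) hT (fun z hz =>
    ((hfat _ (e'.map_target hz)).comp z (hg z hz)).contDiffWithinAt)
  refine measure_mono_null ?_ hnull
  rintro _ ⟨x, ⟨hx, hwx, hdf⟩, rfl⟩
  have h1 : ι (pr x) = e' x := by
    change ((0 : ℝ), pr x) = (w x, pr x)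
    rw [hwx]
  have h2 : e'.symm (ι (pr x)) = x := by rw [h1, e'.left_inv hx]
  have h3 : pr x ∈ T := by
    change ι (pr x) ∈ e'.target
    rw [h1]; exact e'.map_source hx
  refine ⟨pr x, ⟨h3, ?_⟩, by simp only [h2]⟩
  have h4 : fderiv ℝ f (e'.symm (ι (pr x))) = 0 := by rw [h2]; exact hdf
  have := fderiv_comp (𝕜 := ℝ) (pr x) (g := f) (f := fun z => e'.symm (ι z))
    ((hfat _ (by rw [h2]; exact hx)).differentiableAt (by simp))
    ((hg _ h3).differentiableAt (by simp))
  rw [h4, ContinuousLinearMap.zero_comp] at this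
  exact this

/-- **Sard's theorem** for real-valued functions: the critical values of a smooth function on an
open subset of a finite-dimensional space form a null set. -/
theorem volume_image_critical_eq_zero_of_finrank_eq (d : ℕ) :
    ∀ {E : Type u} [NormedAddCommGroup E] [NormedSpace ℝ E] [FiniteDimensional ℝ E],
      Module.finrank ℝ E = d → ∀ {f : E → ℝ} {O : Set E}, IsOpen O → ContDiffOn ℝ ∞ f O →
        volume (f '' {x | x ∈ O ∧ fderiv ℝ f x = 0}) = 0 := by
  induction d with
  | zero =>
    intro E _ _ _ hE f O hO hf
    have := Module.finrank_zero_iff.1 hE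
    exact (Set.subsingleton_of_subsingleton.image f).measure_zero volume
  | succ d ih =>
    intro E _ _ _ hE f O hO hf
    have hflat := volume_image_flat_eq_zero hO hf
    set F := {x | x ∈ O ∧ ∀ i, 1 ≤ i → i ≤ Module.finrank ℝ E → iteratedFDeriv ℝ i f x = 0}
    set C := {x | x ∈ O ∧ fderiv ℝ f x = 0}
    set P : ℕ → Set E := fun k => {x | x ∈ C ∧ iteratedFDeriv ℝ k f x = 0 ∧
      iteratedFDeriv ℝ (k + 1) f x ≠ 0}
    have hcover : C ⊆ F ∪ ⋃ k ∈ {k : ℕ | 1 ≤ k}, P k := by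
      intro x hx
      by_cases h : ∀ i, 1 ≤ i → iteratedFDeriv ℝ i f x = 0
      · exact Or.inl ⟨hx.1, fun i hi _ => h i hi⟩
      · right
        push Not at h
        classical
        have hfind := Nat.find_spec h
        set k := Nat.find h with hk
        have h1 : iteratedFDeriv ℝ 1 f x = 0 := by
          rw [← norm_eq_zero, norm_iteratedFDeriv_one, hx.2, norm_zero]
        have hk2 : 2 ≤ k := by
          by_contra hlt
          have : k = 1 := by omega
          exact hfind.2 (this ▸ h1)
        have hmin := Nat.find_min h (m := k - 1) (by omega)
        push Not at hmin
        refine mem_biUnion (x := k - 1) (by simp only [mem_ofPred_eq]; omega) ⟨hx, hmin (by omega), ?_⟩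
        rw [Nat.sub_add_cancel (by omega)]
        exact hfind.2
    refine measure_mono_null (image_mono hcover) ?_
    rw [image_union, image_iUnion₂]
    refine measure_union_null hflat ((measure_biUnion_null_iff (to_countable _)).2 fun k hk => ?_)
    refine volume_image_null_of_locally_null fun x hx => ?_
    have hsm : ∀ z ∈ O, ContDiffAt ℝ ∞ (iteratedFDeriv ℝ k f) z := fun z hz =>
      (hf.contDiffAt (hO.mem_nhds hz)).iteratedFDeriv_right (by exact_mod_cast le_top)
    obtain ⟨v, hv⟩ : ∃ v, fderiv ℝ (iteratedFDeriv ℝ k f) x v ≠ 0 := by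
      by_contra! h
      have h1 : ‖fderiv ℝ (iteratedFDeriv ℝ k f) x‖ ≤ 0 :=
        ContinuousLinearMap.opNorm_le_bound _ le_rfl fun v => by rw [h v]; simp
      rw [norm_fderiv_iteratedFDeriv] at h1
      exact hx.2.2 (norm_le_zero_iff.1 h1)
    obtain ⟨φ, hφ⟩ := SeparatingDual.exists_ne_zero (R := ℝ) hv
    obtain ⟨V, hV, hV0⟩ := exists_nhds_volume_image_hypersurface_eq_zero ih hE hO hf
      (w := fun z => φ (iteratedFDeriv ℝ k f z))
      (fun z hz => (φ.contDiff.contDiffAt.comp z (hsm z hz)).contDiffWithinAt) hx.1.1 (by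
        intro h0
        have h1 := (φ.hasFDerivAt.comp x ((hsm x hx.1.1).differentiableAt (by simp)).hasFDerivAt)
        have h2 := h1.fderiv.symm.trans h0
        exact hφ (congrArg (fun g => g v) h2))
    refine ⟨_, Filter.inter_mem self_mem_nhdsWithin (mem_nhdsWithin_of_mem_nhds hV),
      measure_mono_null (image_mono ?_) hV0⟩
    rintro z ⟨hz, hzV⟩
    exact ⟨hzV, by simp [hz.2.1], hz.1.2⟩

theorem volume_image_critical_eq_zero {E : Type*} [NormedAddCommGroup E] [NormedSpace ℝ E]
    [FiniteDimensional ℝ E] {f : E → ℝ} {O : Set E} (hO : IsOpen O) (hf : ContDiffOn ℝ ∞ f O) :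
    volume (f '' {x | x ∈ O ∧ fderiv ℝ f x = 0}) = 0 :=
  volume_image_critical_eq_zero_of_finrank_eq _ rfl hO hf

/-! ### Affine families of functions -/

section AffineFamily

variable {E V : Type*} [NormedAddCommGroup E] [NormedSpace ℝ E] [FiniteDimensional ℝ E]
  [NormedAddCommGroup V] [NormedSpace ℝ V] [FiniteDimensional ℝ V]

/-- Local form of `ae_fderiv_affine_family_ne_zero`. -/
theorem exists_nhds_ae_fderiv_affine_family_ne_zero [MeasurableSpace V] [BorelSpace V]
    (μ : Measure V) [μ.IsAddHaarMeasure] {O : Set E} (hO : IsOpen O) {a : E → ℝ}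
    {b : E → V →L[ℝ] ℝ} (ha : ContDiffOn ℝ ∞ a O) (hb : ContDiffOn ℝ ∞ b O) {x₀ : E}
    (hx₀ : x₀ ∈ O) (hbx₀ : b x₀ ≠ 0) :
    ∃ U ∈ 𝓝 x₀, ∀ᵐ v ∂μ, ∀ x ∈ U, a x + b x v = 0 → fderiv ℝ (fun z => a z + b z v) x ≠ 0 := by
  have : ProperSpace E := FiniteDimensional.proper ℝ E
  have : ProperSpace V := FiniteDimensional.proper ℝ V
  obtain ⟨r, hr⟩ : ∃ r, b x₀ r ≠ 0 := by
    by_contra! h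
    exact hbx₀ (ContinuousLinearMap.ext h)
  have hbr : ContDiffOn ℝ ∞ (fun x => b x r) O := hb.clm_apply contDiffOn_const
  set W := O ∩ (fun x => b x r) ⁻¹' {0}ᶜ
  have hW : IsOpen W := hbr.continuousOn.isOpen_inter_preimage hO isOpen_compl_singleton
  obtain ⟨K, hK, hxK, hKW⟩ := exists_compact_subset hW (x := x₀) ⟨hx₀, hr⟩
  refine ⟨K, mem_interior_iff_mem_nhds.1 hxK, ?_⟩
  have hda : ∀ x ∈ O, HasFDerivAt a (fderiv ℝ a x) x := fun x hx =>
    ((ha.contDiffAt (hO.mem_nhds hx)).differentiableAt (by simp)).hasFDerivAt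
  have hdb : ∀ x ∈ O, HasFDerivAt b (fderiv ℝ b x) x := fun x hx =>
    ((hb.contDiffAt (hO.mem_nhds hx)).differentiableAt (by simp)).hasFDerivAt
  have hdv : ∀ x ∈ O, ∀ v, HasFDerivAt (fun z => b z v) ((fderiv ℝ b x).flip v) x := by
    intro x hx v
    convert! (hdb x hx).clm_apply (hasFDerivAt_const v x) using 1
    ext; simp
  have hd : ∀ x ∈ O, ∀ v, HasFDerivAt (fun z => a z + b z v)
      (fderiv ℝ a x + (fderiv ℝ b x).flip v) x := fun x hx v => (hda x hx).add (hdv x hx v)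
  -- the set of exceptional parameters is closed, as the projection of a closed subset of `K × V`
  set B : Set V := {v | ∃ x ∈ K, a x + b x v = 0 ∧ fderiv ℝ (fun z => a z + b z v) x = 0}
  have hclosed : IsClosed B := by
    have : CompactSpace K := isCompact_iff_compactSpace.1 hK
    have c1 : Continuous (fun x : K => a x) :=
      (ha.continuousOn.mono fun x hx => (hKW hx).1).domRestrict
    have c2 : Continuous (fun x : K => b x) :=
      (hb.continuousOn.mono fun x hx => (hKW hx).1).domRestrict
    have c3 : Continuous (fun x : K => fderiv ℝ a x) :=
      ((ha.continuousOn_fderiv_of_isOpen hO (by simp)).mono fun x hx => (hKW hx).1).domRestrict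
    have c4 : Continuous (fun x : K => fderiv ℝ b x) :=
      ((hb.continuousOn_fderiv_of_isOpen hO (by simp)).mono fun x hx => (hKW hx).1).domRestrict
    set Z : Set (K × V) := {z | a z.1 + b z.1 z.2 = 0 ∧
      fderiv ℝ a z.1 + (fderiv ℝ b z.1).flip z.2 = 0}
    have hZ : IsClosed Z := by
      refine (isClosed_eq ?_ continuous_const).inter (isClosed_eq ?_ continuous_const)
      · exact (c1.comp continuous_fst).add ((c2.comp continuous_fst).clm_apply continuous_snd)
      · refine (c3.comp continuous_fst).add (Continuous.clm_apply ?_ continuous_snd)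
        exact (ContinuousLinearMap.flipₗᵢ ℝ E V ℝ).continuous.comp (c4.comp continuous_fst)
    convert isClosedMap_snd_of_compactSpace Z hZ using 1
    ext v
    constructor
    · rintro ⟨x, hx, h1, h2⟩
      exact ⟨(⟨x, hx⟩, v), ⟨h1, (hd x (hKW hx).1 v).fderiv ▸ h2⟩, rfl⟩
    · rintro ⟨⟨⟨x, hx⟩, v⟩, ⟨h1, h2⟩, rfl⟩
      exact ⟨x, hx, h1, (hd x (hKW hx).1 v).fderiv.trans h2⟩
  have hae : ∀ᵐ v ∂μ, v ∈ Bᶜ := by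
    refine ae_mem_of_ae_add_linearMap_mem (LinearMap.toSpanSingleton ℝ V r) volume μ
      hclosed.measurableSet.compl fun v₀ => ?_
    -- along the line `v₀ + t r`, the exceptional `t` are critical values of `ψ`
    set ψ : E → ℝ := fun x => -(a x + b x v₀) / b x r
    have hψ : ContDiffOn ℝ ∞ ψ W := by
      refine ContDiffOn.div ?_ (hbr.mono inter_subset_left) fun x hx => hx.2
      exact ((ha.add (hb.clm_apply contDiffOn_const)).neg).mono inter_subset_left
    refine measure_mono_null ?_ (volume_image_critical_eq_zero hW hψ)
    intro t ht
    simp only [LinearMap.toSpanSingleton_apply, mem_compl_iff] at ht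
    obtain ⟨x, hxK, h1, h2⟩ : v₀ + t • r ∈ B := by
      by_contra h
      exact ht h
    obtain ⟨hxO, hxr⟩ := hKW hxK
    have hxr : b x r ≠ 0 := hxr
    have htψ : ψ x = t := by
      simp only [ψ]
      rw [map_add, map_smul, smul_eq_mul] at h1
      field_simp
      linarith
    refine ⟨x, ⟨⟨hxO, hxr⟩, ?_⟩, htψ⟩
    have hdψ := ((hψ.contDiffAt (hW.mem_nhds ⟨hxO, hxr⟩)).differentiableAt (by simp)).hasFDerivAt
    have h3 : HasFDerivAt (fun z => (t - ψ z) * b z r) (-(b x r • fderiv ℝ ψ x)) x := by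
      have := (hdψ.const_sub t).mul (hdv x hxO r)
      rw [htψ, sub_self, zero_smul, zero_add, smul_neg] at this
      exact this
    have h4 : (fun z => a z + b z (v₀ + t • r)) =ᶠ[𝓝 x] fun z => (t - ψ z) * b z r := by
      filter_upwards [hW.mem_nhds ⟨hxO, hxr⟩] with z hz
      have : b z r ≠ 0 := hz.2
      simp only [ψ, map_add, map_smul, smul_eq_mul]
      field_simp
      ring
    have h5 := (h3.congr_of_eventuallyEq h4).fderiv
    rw [h2] at h5
    have h6 : b x r • fderiv ℝ ψ x = 0 := by
      rw [← neg_eq_zero]; exact h5.symm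
    exact (smul_eq_zero.1 h6).resolve_left hxr
  filter_upwards [hae] with v hv x hx h1 h2
  exact hv ⟨x, hx, h1, h2⟩

/-- **Parametric transversality** for real-valued functions depending affinely on the parameter:
for almost every `v`, zero is a regular value of `a + b v` on the set where `b ≠ 0`. -/
theorem ae_fderiv_affine_family_ne_zero [MeasurableSpace V] [BorelSpace V]
    (μ : Measure V) [μ.IsAddHaarMeasure] {O : Set E} (hO : IsOpen O) {a : E → ℝ}
    {b : E → V →L[ℝ] ℝ} (ha : ContDiffOn ℝ ∞ a O) (hb : ContDiffOn ℝ ∞ b O) :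
    ∀ᵐ v ∂μ, ∀ x ∈ O, b x ≠ 0 → a x + b x v = 0 → fderiv ℝ (fun z => a z + b z v) x ≠ 0 := by
  have : ProperSpace E := FiniteDimensional.proper ℝ E
  choose! U hU hae using fun x (hx : x ∈ {x | x ∈ O ∧ b x ≠ 0}) =>
    exists_nhds_ae_fderiv_affine_family_ne_zero μ hO ha hb hx.1 hx.2
  obtain ⟨t, hts, htc, ht⟩ := TopologicalSpace.countable_cover_nhdsWithin
    fun x hx => mem_nhdsWithin_of_mem_nhds (hU x hx)
  filter_upwards [(ae_ball_iff htc).2 fun x hx => hae x (hts hx)] with v hv x hxO hbx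
  obtain ⟨y, hy, hxy⟩ := mem_iUnion₂.1 (ht ⟨hxO, hbx⟩)
  exact hv y hy x hxy

/-- The case of `ae_fderiv_affine_family_ne_zero` where the parameters are families of points. -/
theorem ae_fderiv_affine_family_points_ne_zero {ℓ m : ℕ} {O : Set E} (hO : IsOpen O) {a : E → ℝ}
    {c : Fin ℓ → Fin m → E → ℝ} (ha : ContDiffOn ℝ ∞ a O) (hc : ∀ i j, ContDiffOn ℝ ∞ (c i j) O) :
    ∀ᵐ p : Fin ℓ → Euc m, ∀ x ∈ O, (∃ i j, c i j x ≠ 0) →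
      a x + ∑ i, ∑ j, c i j x * p i j = 0 →
      fderiv ℝ (fun z => a z + ∑ i, ∑ j, c i j z * p i j) x ≠ 0 := by
  set pr : Fin ℓ → Fin m → (Fin ℓ → Euc m) →L[ℝ] ℝ := fun i j =>
    (EuclideanSpace.proj j).comp (ContinuousLinearMap.proj (R := ℝ) (φ := fun _ : Fin ℓ => Euc m) i)
  set b : E → (Fin ℓ → Euc m) →L[ℝ] ℝ := fun x => ∑ i, ∑ j, c i j x • pr i j
  have hb : ContDiffOn ℝ ∞ b O := ContDiffOn.sum fun i _ => ContDiffOn.sum fun j _ =>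
    (hc i j).smul contDiffOn_const
  have hbv : ∀ x p, b x p = ∑ i, ∑ j, c i j x * p i j := fun x p => by
    simp [b, pr]
  filter_upwards [ae_fderiv_affine_family_ne_zero volume hO ha hb] with p hp x hx hne
  have := hp x hx ?_
  · simpa only [hbv] using this
  · obtain ⟨i, j, hij⟩ := hne
    intro h0
    have h1 := hbv x (Pi.single i (EuclideanSpace.single j 1))
    rw [h0] at h1
    apply hij
    rw [zero_apply, Finset.sum_eq_single i, Finset.sum_eq_single j] at h1
    · simpa using h1.symm
    · intro j' _ hj'
      simp [hj']
    · simp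
    · intro i' _ hi'
      simp [hi']
    · simp

end AffineFamily

/-! ### Distance-squared mappings along a smooth map -/

theorem contDiff_genDistSq {m ℓ : ℕ} (p : Fin ℓ → Euc m) (A : Matrix (Fin ℓ) (Fin m) ℝ) :
    ContDiff ℝ ∞ (genDistSq p A) := by
  rw [contDiff_euclidean]
  intro i
  simp only [genDistSq]
  fun_prop

theorem fderiv_genDistSq_comp_apply {E : Type*} [NormedAddCommGroup E] [NormedSpace ℝ E]
    {m ℓ : ℕ} (p : Fin ℓ → Euc m) (A : Matrix (Fin ℓ) (Fin m) ℝ) {F : E → Euc m} {y : E}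
    (hF : DifferentiableAt ℝ F y) (u : E) (i : Fin ℓ) :
    fderiv ℝ (genDistSq p A ∘ F) y u i =
      ∑ j, 2 * A i j * (F y j - p i j) * fderiv ℝ F y u j := by
  have hd : DifferentiableAt ℝ (genDistSq p A ∘ F) y :=
    ((contDiff_genDistSq p A).differentiable (by simp)).differentiableAt.comp y hF
  have hj : ∀ j, HasFDerivAt (fun z => F z j) ((EuclideanSpace.proj j).comp (fderiv ℝ F y)) y :=
    fun j => (EuclideanSpace.proj j : Euc m →L[ℝ] ℝ).hasFDerivAt.comp y
      hF.hasFDerivAt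
  have h1 : HasFDerivAt (fun z => (genDistSq p A ∘ F) z i)
      ((EuclideanSpace.proj i).comp (fderiv ℝ (genDistSq p A ∘ F) y)) y :=
    (EuclideanSpace.proj i : Euc ℓ →L[ℝ] ℝ).hasFDerivAt.comp y hd.hasFDerivAt
  have h2 : HasFDerivAt (fun z => ∑ j, A i j * (F z j - p i j) ^ 2) _ y :=
    HasFDerivAt.fun_sum fun j _ => (((hj j).sub_const (p i j)).pow 2).const_mul (A i j)
  have h3 := congrArg (fun T => T u) (h1.unique h2)
  simp only [ContinuousLinearMap.comp_apply, PiLp.proj_apply] at h3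
  rw [h3]
  simp
  refine Finset.sum_congr rfl fun j _ => ?_
  ring

/-! ### Transversality of the 1-jet to the orbits of the left-right action -/

/-- The derivative `L` of `h` at `x`, as `x` varies, is transverse at `x` to the orbit of `L` under
the action of `GL(ℓ) × GL(n)` on linear maps, whose tangent space at `L` is `{A L + L B}`. -/
def OrbitTransverseAt {n ℓ : ℕ} (h : Euc n → Euc ℓ) (x : Euc n) : Prop :=
  ∀ T : Euc n →L[ℝ] Euc ℓ, ∃ (v : Euc n) (A : Euc ℓ →L[ℝ] Euc ℓ) (B : Euc n →L[ℝ] Euc n),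
    T = fderiv ℝ (fderiv ℝ h) x v + A ∘L fderiv ℝ h x + fderiv ℝ h x ∘L B

theorem OrbitTransverseAt.congr {n ℓ : ℕ} {h h' : Euc n → Euc ℓ} {x : Euc n}
    (H : OrbitTransverseAt h x) (e : h' =ᶠ[𝓝 x] h) : OrbitTransverseAt h' x := by
  intro T
  obtain ⟨v, A, B, hT⟩ := H T
  exact ⟨v, A, B, by rw [e.fderiv.fderiv_eq, e.fderiv_eq, hT]⟩

/-- The second derivative of a local diffeomorphism `τ` contributes to the second derivative of
`h ∘ τ` only terms that are tangent to the orbit. -/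
theorem OrbitTransverseAt.comp {n ℓ : ℕ} {h : Euc n → Euc ℓ} {τ : Euc n → Euc n} {x : Euc n}
    (H : OrbitTransverseAt h (τ x)) (hh : ContDiffAt ℝ ∞ h (τ x)) (hτ : ContDiffAt ℝ ∞ τ x)
    (e : Euc n ≃L[ℝ] Euc n) (he : (e : Euc n →L[ℝ] Euc n) = fderiv ℝ τ x) :
    OrbitTransverseAt (h ∘ τ) x := by
  intro T
  obtain ⟨u, A, B, hT⟩ := H (T ∘L (e.symm : Euc n →L[ℝ] Euc n))
  have hev : fderiv ℝ (h ∘ τ) =ᶠ[𝓝 x] fun z => (fderiv ℝ h (τ z)).comp (fderiv ℝ τ z) := by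
    have h1 : ∀ᶠ z in 𝓝 x, DifferentiableAt ℝ τ z :=
      ((hτ.of_le (m := 1) (by exact_mod_cast le_top)).eventually (by simp)).mono
        fun z hz => hz.differentiableAt one_ne_zero
    have h2 : ∀ᶠ z in 𝓝 x, DifferentiableAt ℝ h (τ z) :=
      hτ.continuousAt.eventually
        (((hh.of_le (m := 1) (by exact_mod_cast le_top)).eventually (by simp)).mono
          fun z hz => hz.differentiableAt one_ne_zero)
    filter_upwards [h1, h2] with z hz1 hz2
    exact fderiv_comp z hz2 hz1
  have d1 : HasFDerivAt (fderiv ℝ h) (fderiv ℝ (fderiv ℝ h) (τ x)) (τ x) :=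
    ((hh.fderiv_right (m := 1) (by norm_cast)).differentiableAt
      one_ne_zero).hasFDerivAt
  have d2 : HasFDerivAt (fderiv ℝ τ) (fderiv ℝ (fderiv ℝ τ) x) x :=
    ((hτ.fderiv_right (m := 1) (by norm_cast)).differentiableAt
      one_ne_zero).hasFDerivAt
  have d3 : HasFDerivAt τ (fderiv ℝ τ x) x := (hτ.differentiableAt (by simp)).hasFDerivAt
  have d4 := ((d1.comp x d3).clm_comp d2).congr_of_eventuallyEq hev
  have hL : fderiv ℝ (h ∘ τ) x = (fderiv ℝ h (τ x)).comp (fderiv ℝ τ x) := hev.self_of_nhds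
  refine ⟨e.symm u, A, (e.symm : Euc n →L[ℝ] Euc n) ∘L B ∘L (e : Euc n →L[ℝ] Euc n) -
    (e.symm : Euc n →L[ℝ] Euc n) ∘L (fderiv ℝ (fderiv ℝ τ) x (e.symm u)), ?_⟩
  rw [d4.fderiv, hL, ← he]
  ext1 w
  have hTw := congrArg (fun S => S (e w)) hT
  simp at hTw
  simp [hTw]
  abel

section Duality

variable {n ℓ : ℕ}

/-- Every linear functional on the linear maps `ℝ^n → ℝ^ℓ` is of the form `T ↦ tr (T C)`. -/
theorem exists_functional_eq_sum (f : (Euc n →L[ℝ] Euc ℓ) →ₗ[ℝ] ℝ) :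
    ∃ C : Euc ℓ →L[ℝ] Euc n, ∀ T, f T = ∑ i, T (C (EuclideanSpace.single i 1)) i := by
  set R : Fin ℓ → Fin n → (Euc n →L[ℝ] Euc ℓ) := fun i j =>
    (EuclideanSpace.proj j : Euc n →L[ℝ] ℝ).smulRight
      (EuclideanSpace.single i (1 : ℝ) : Euc ℓ)
  set c : Fin ℓ → Euc n := fun i => WithLp.toLp 2 fun j => f (R i j)
  refine ⟨∑ i, (EuclideanSpace.proj i : Euc ℓ →L[ℝ] ℝ).smulRight (c i),
    fun T => ?_⟩
  have hT : T = ∑ i, ∑ j, T (EuclideanSpace.single j 1) i • R i j := by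
    refine ContinuousLinearMap.coe_injective ((EuclideanSpace.basisFun (Fin n) ℝ).toBasis.ext fun k => ?_)
    ext i
    simp [R, Finset.sum_apply, Pi.single_apply, PiLp.single_apply]
  have hC : ∀ i, (∑ i, (EuclideanSpace.proj i : Euc ℓ →L[ℝ] ℝ).smulRight (c i))
      (EuclideanSpace.single i 1) = c i := by
    intro i
    simp [PiLp.single_apply]
  have hsum : ∀ i, c i = ∑ j, f (R i j) • EuclideanSpace.single j (1 : ℝ) := by
    intro i
    ext j
    simp [c, Finset.sum_apply, Pi.single_apply]
  conv_lhs => rw [hT]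
  simp only [hC]
  simp only [map_sum, map_smul, smul_eq_mul]
  refine Finset.sum_congr rfl fun i _ => ?_
  conv_rhs => rw [hsum i]
  simp [mul_comm]

/-- If `OrbitTransverseAt h x` fails, some `C ≠ 0` annihilates, in the trace pairing, the second
derivative and the tangent space of the orbit; the latter means that `L C = 0` and `C L = 0`. -/
theorem exists_annihilator_of_not_orbitTransverseAt {h : Euc n → Euc ℓ} {x : Euc n}
    (H : ¬ OrbitTransverseAt h x) : ∃ C : Euc ℓ →L[ℝ] Euc n, C ≠ 0 ∧
      (∀ v, ∑ i, fderiv ℝ (fderiv ℝ h) x v (C (EuclideanSpace.single i 1)) i = 0) ∧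
      fderiv ℝ h x ∘L C = 0 ∧ C ∘L fderiv ℝ h x = 0 := by
  set L := fderiv ℝ h x
  set S : Submodule ℝ (Euc n →L[ℝ] Euc ℓ) :=
    (LinearMap.range (fderiv ℝ (fderiv ℝ h) x : Euc n →ₗ[ℝ] _)) ⊔
    (LinearMap.range (((ContinuousLinearMap.compL ℝ (Euc n) (Euc ℓ) (Euc ℓ)).flip L : _ →L[ℝ] _) :
      (Euc ℓ →L[ℝ] Euc ℓ) →ₗ[ℝ] _)) ⊔
    (LinearMap.range ((ContinuousLinearMap.compL ℝ (Euc n) (Euc n) (Euc ℓ) L : _ →L[ℝ] _) :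
      (Euc n →L[ℝ] Euc n) →ₗ[ℝ] _))
  have hS : S < ⊤ := by
    rw [lt_top_iff_ne_top]
    intro htop
    refine H fun T => ?_
    have hT : T ∈ S := htop ▸ Submodule.mem_top
    obtain ⟨y, hy, _, ⟨B, rfl⟩, rfl⟩ := Submodule.mem_sup.1 hT
    obtain ⟨_, ⟨v, rfl⟩, _, ⟨A, rfl⟩, rfl⟩ := Submodule.mem_sup.1 hy
    exact ⟨v, A, B, rfl⟩
  obtain ⟨f, hf0, hf⟩ := Submodule.exists_le_ker_of_lt_top S hS
  obtain ⟨C, hC⟩ := exists_functional_eq_sum f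
  have hvan : ∀ T ∈ S, ∑ i, T (C (EuclideanSpace.single i 1)) i = 0 := fun T hT =>
    (hC T).symm.trans (hf hT)
  refine ⟨C, ?_, fun v => hvan _ (Submodule.mem_sup_left (Submodule.mem_sup_left ⟨v, rfl⟩)),
    ?_, ?_⟩
  · rintro rfl
    exact hf0 (LinearMap.ext fun T => by simp [hC])
  · refine ContinuousLinearMap.coe_injective
      ((EuclideanSpace.basisFun (Fin ℓ) ℝ).toBasis.ext fun i => ?_)
    ext k
    have := hvan _ (Submodule.mem_sup_left (Submodule.mem_sup_right ⟨
      (EuclideanSpace.proj k : Euc ℓ →L[ℝ] ℝ).smulRight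
        (EuclideanSpace.single i (1 : ℝ) : Euc ℓ), rfl⟩))
    simpa [PiLp.single_apply] using this
  · ext u j
    have := hvan _ (Submodule.mem_sup_right ⟨
      (EuclideanSpace.proj j : Euc n →L[ℝ] ℝ).smulRight u, rfl⟩)
    have hu : L u = ∑ i, L u i • EuclideanSpace.single i (1 : ℝ) := by
      ext k; simp [Finset.sum_apply, Pi.single_apply]
    rw [ContinuousLinearMap.comp_apply, hu]
    simpa [mul_comm] using this

end Duality

theorem sum_single_apply_eq_trace {ℓ : ℕ} (M : Euc ℓ →L[ℝ] Euc ℓ) :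
    ∑ i, M (EuclideanSpace.single i 1) i = LinearMap.trace ℝ (Euc ℓ) (M : Euc ℓ →ₗ[ℝ] Euc ℓ) := by
  rw [LinearMap.trace_eq_sum_inner _ (EuclideanSpace.basisFun (Fin ℓ) ℝ)]
  simp [EuclideanSpace.inner_single_left]

theorem hasFDerivAt_clm_apply_apply {E F G H : Type*} [NormedAddCommGroup E] [NormedSpace ℝ E]
    [NormedAddCommGroup F] [NormedSpace ℝ F] [NormedAddCommGroup G] [NormedSpace ℝ G]
    [NormedAddCommGroup H] [NormedSpace ℝ H] {M : E → F →L[ℝ] G} {M' : E →L[ℝ] F →L[ℝ] G} {y : E}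
    (hM : HasFDerivAt M M' y) (κ : H →L[ℝ] F) (ρ : H →L[ℝ] H) (e : H) :
    ∃ D : E × (H →L[ℝ] F) × (H →L[ℝ] H) →L[ℝ] G,
      HasFDerivAt (fun x : E × (H →L[ℝ] F) × (H →L[ℝ] H) => M x.1 (x.2.1 (x.2.2 e))) D (y, κ, ρ) ∧
      ∀ δ, D δ = M' δ.1 (κ (ρ e)) + M y (δ.2.1 (ρ e)) + M y (κ (δ.2.2 e)) := by
  have d1 : HasFDerivAt (fun x : E × (H →L[ℝ] F) × (H →L[ℝ] H) => M x.1) _ (y, κ, ρ) :=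
    HasFDerivAt.comp (y, κ, ρ) hM hasFDerivAt_fst
  have d2 : HasFDerivAt (fun x : E × (H →L[ℝ] F) × (H →L[ℝ] H) => x.2.1) _ (y, κ, ρ) :=
    ((ContinuousLinearMap.fst ℝ (H →L[ℝ] F) (H →L[ℝ] H)).comp
      (ContinuousLinearMap.snd ℝ E _)).hasFDerivAt
  have d3 : HasFDerivAt (fun x : E × (H →L[ℝ] F) × (H →L[ℝ] H) => x.2.2) _ (y, κ, ρ) :=
    ((ContinuousLinearMap.snd ℝ (H →L[ℝ] F) (H →L[ℝ] H)).comp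
      (ContinuousLinearMap.snd ℝ E _)).hasFDerivAt
  refine ⟨_, d1.clm_apply (d2.clm_apply (d3.clm_apply (hasFDerivAt_const e _))), fun δ => ?_⟩
  simp
  abel

/-- An annihilator `C` as in `exists_annihilator_of_not_orbitTransverseAt` is the product of `κ = C`
and of the orthogonal projection `ρ` to the complement of the range of the derivative `L` of
`G_p ∘ F`. Then `(y, κ, ρ)` is a critical zero of the function `tr (L κ ρ)` of three variables,
which is affine in `p`; for almost all `p` there is none. -/
theorem ae_orbitTransverseAt_genDistSq_comp {n m ℓ : ℕ} {A : Matrix (Fin ℓ) (Fin m) ℝ}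
    (hA : ∀ i j, A i j ≠ 0) {F : Euc n → Euc m} {O : Set (Euc n)} (hO : IsOpen O)
    (hF : ContDiffOn ℝ ∞ F O) (hinj : ∀ y ∈ O, Function.Injective (fderiv ℝ F y)) :
    ∀ᵐ p : Fin ℓ → Euc m, ∀ y ∈ O, OrbitTransverseAt (genDistSq p A ∘ F) y := by
  set W := Euc n × (Euc ℓ →L[ℝ] Euc n) × (Euc ℓ →L[ℝ] Euc ℓ)
  set u : Fin ℓ → W → Euc n := fun i x => x.2.1 (x.2.2 (EuclideanSpace.single i 1))
  set D : Fin ℓ → Fin m → W → ℝ := fun i j x => fderiv ℝ F x.1 (u i x) j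
  set O' : Set W := Prod.fst ⁻¹' O
  have hO' : IsOpen O' := hO.preimage continuous_fst
  have hu : ∀ i, ContDiff ℝ ∞ (u i) := fun i =>
    (contDiff_fst.comp contDiff_snd).clm_apply
      ((contDiff_snd.comp contDiff_snd).clm_apply contDiff_const)
  have hdF : ContDiffOn ℝ ∞ (fderiv ℝ F) O := hF.fderiv_of_isOpen hO (by simp)
  have hD : ∀ i j, ContDiffOn ℝ ∞ (D i j) O' := fun i j => by
    have h1 : ContDiffOn ℝ ∞ (fun x : W => fderiv ℝ F x.1 (u i x)) O' :=
      (hdF.comp contDiff_fst.contDiffOn fun x hx => hx).clm_apply (hu i).contDiffOn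
    exact contDiffOn_euclidean.1 h1 j
  have hFj : ∀ j, ContDiffOn ℝ ∞ (fun x : W => F x.1 j) O' := fun j =>
    contDiffOn_euclidean.1 (hF.comp contDiff_fst.contDiffOn fun x hx => hx) j
  have hae := ae_fderiv_affine_family_points_ne_zero (ℓ := ℓ) (m := m) hO'
    (a := fun x => ∑ i, ∑ j, 2 * A i j * F x.1 j * D i j x)
    (c := fun i j x => -2 * A i j * D i j x)
    (ContDiffOn.sum fun i _ => ContDiffOn.sum fun j _ =>
      (contDiffOn_const.mul (hFj j)).mul (hD i j))
    (fun i j => contDiffOn_const.mul (hD i j))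
  filter_upwards [hae] with p hp y hy
  by_contra hnot
  obtain ⟨C, hC0, hC1, hC2, hC3⟩ := exists_annihilator_of_not_orbitTransverseAt hnot
  set h := genDistSq p A ∘ F
  set L := fderiv ℝ h y
  have hh : ∀ z ∈ O, ContDiffAt ℝ ∞ h z := fun z hz =>
    (contDiff_genDistSq p A).contDiffAt.comp z (hF.contDiffAt (hO.mem_nhds hz))
  set R := LinearMap.range (L : Euc n →ₗ[ℝ] Euc ℓ)
  set ρ : Euc ℓ →L[ℝ] Euc ℓ := Rᗮ.starProjection
  have hρL : ρ ∘L L = 0 := by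
    ext1 v
    exact Submodule.starProjection_orthogonal_apply_eq_zero (LinearMap.mem_range_self _ v)
  have hCρ : C ∘L ρ = C := by
    ext1 v
    have h1 : R.starProjection v + ρ v = v := Submodule.starProjection_add_starProjection_orthogonal v
    obtain ⟨w, hw⟩ : R.starProjection v ∈ R := Submodule.starProjection_apply_mem R v
    have h2 : C (R.starProjection v) = 0 := by
      rw [← hw]; exact congrArg (fun S => S w) hC3
    conv_rhs => rw [← h1, map_add, h2, zero_add]
    rfl
  have hux : ∀ i, u i (y, C, ρ) = C (EuclideanSpace.single i 1) := fun i =>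
    congrArg (fun S => S (EuclideanSpace.single i (1 : ℝ))) hCρ
  have heq : ∀ x ∈ O', (∑ i, ∑ j, 2 * A i j * F x.1 j * D i j x) +
      ∑ i, ∑ j, -2 * A i j * D i j x * p i j = ∑ i, fderiv ℝ h x.1 (u i x) i := by
    intro x hx
    rw [← Finset.sum_add_distrib]
    refine Finset.sum_congr rfl fun i _ => ?_
    rw [fderiv_genDistSq_comp_apply p A
      ((hF.contDiffAt (hO.mem_nhds hx)).differentiableAt (by simp)), ← Finset.sum_add_distrib]
    refine Finset.sum_congr rfl fun j _ => ?_
    ring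
  have hLC : ∀ v, L (C v) = 0 := fun v => congrArg (fun S => S v) hC2
  refine hp (y, C, ρ) hy ?_ ?_ ?_
  · obtain ⟨i, hi⟩ : ∃ i, C (EuclideanSpace.single i 1) ≠ 0 := by
      by_contra! hzero
      refine hC0 (ContinuousLinearMap.coe_injective
        ((EuclideanSpace.basisFun (Fin ℓ) ℝ).toBasis.ext fun i => ?_))
      simpa using hzero i
    have h1 : fderiv ℝ F y (C (EuclideanSpace.single i 1)) ≠ 0 := fun h0 =>
      hi (hinj y hy (h0.trans (map_zero _).symm))
    obtain ⟨j, hj⟩ : ∃ j, fderiv ℝ F y (C (EuclideanSpace.single i 1)) j ≠ 0 := by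
      by_contra! hzero
      exact h1 (by ext j; simpa using hzero j)
    refine ⟨i, j, mul_ne_zero (mul_ne_zero (by norm_num) (hA i j)) ?_⟩
    simpa [D, hux] using hj
  · rw [heq _ hy]
    simp [hux, hLC, L]
  · have hev : (fun x => (∑ i, ∑ j, 2 * A i j * F x.1 j * D i j x) +
      ∑ i, ∑ j, -2 * A i j * D i j x * p i j) =ᶠ[𝓝 (y, C, ρ)]
        fun x => ∑ i, fderiv ℝ h x.1 (u i x) i := by
      filter_upwards [hO'.mem_nhds hy] with x hx using heq x hx
    rw [hev.fderiv_eq]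
    choose E hE hEapp using fun i : Fin ℓ => hasFDerivAt_clm_apply_apply
      (((hh y hy).fderiv_right (m := 1) (by norm_cast)).differentiableAt
        one_ne_zero).hasFDerivAt C ρ (EuclideanSpace.single i (1 : ℝ))
    have d3 : HasFDerivAt (fun x : W => ∑ i, fderiv ℝ h x.1 (u i x) i)
        (∑ i, (EuclideanSpace.proj i : Euc ℓ →L[ℝ] ℝ).comp (E i)) (y, C, ρ) :=
      HasFDerivAt.fun_sum fun i _ =>
        (EuclideanSpace.proj i : Euc ℓ →L[ℝ] ℝ).hasFDerivAt.comp (y, C, ρ) (hE i)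
    rw [d3.fderiv]
    refine ContinuousLinearMap.ext fun ⟨δy, δκ, δρ⟩ => ?_
    have t1 := hC1 δy
    -- cyclicity of the trace moves `ρ` next to `L`
    have t2 : ∑ i, L (δκ (ρ (EuclideanSpace.single i 1))) i = 0 := by
      have e1 := sum_single_apply_eq_trace ((L ∘L δκ) ∘L ρ)
      have e2 := LinearMap.trace_mul_comm ℝ ((L ∘L δκ : Euc ℓ →L[ℝ] Euc ℓ) : Euc ℓ →ₗ[ℝ] Euc ℓ)
        (ρ : Euc ℓ →ₗ[ℝ] Euc ℓ)
      have e3 : (ρ : Euc ℓ →ₗ[ℝ] Euc ℓ) * ((L ∘L δκ : Euc ℓ →L[ℝ] Euc ℓ) : Euc ℓ →ₗ[ℝ] Euc ℓ)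
          = 0 := by
        ext1 v
        exact congrArg (fun S => S (δκ v)) hρL
      rw [e3, map_zero] at e2
      exact e1.trans e2
    have t3 : ∀ i, C (ρ (EuclideanSpace.single i 1)) = C (EuclideanSpace.single i 1) := hux
    have t4 : ∀ v, fderiv ℝ h y (C v) = 0 := hLC
    simp only [sum_apply, ContinuousLinearMap.comp_apply, hEapp, t3, t4]
    simpa [Finset.sum_add_distrib, t1] using t2

/-! ### Tangent vectors of subsets and the 1-jet bundle -/

/-- A curve in `W` through `y` that is given in the preferred chart at `y` has as velocity the
derivative of its coordinate expression. -/
theorem deriv_mem_tangentSpaceOf {E' H' P : Type*} [NormedAddCommGroup E'] [NormedSpace ℝ E']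
    [TopologicalSpace H'] [TopologicalSpace P] [ChartedSpace H' P]
    {J : ModelWithCorners ℝ E' H'} [J.Boundaryless] [IsManifold J ∞ P] {W : Set P} {y : P}
    {c : ℝ → E'} (hc : ContDiff ℝ ∞ c) (h0 : c 0 = extChartAt J y y)
    (hW : ∀ᶠ t in 𝓝 (0 : ℝ), (extChartAt J y).symm (c t) ∈ W) :
    (deriv c 0 : E') ∈ tangentSpaceOf J W y := by
  set γ : ℝ → P := fun t => (extChartAt J y).symm (c t)
  have hγ0 : γ 0 = y := by
    change (extChartAt J y).symm (c 0) = y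
    rw [h0, extChartAt_to_inv]
  have htgt : ∀ᶠ t in 𝓝 (0 : ℝ), c t ∈ (extChartAt J y).target := by
    refine hc.continuous.continuousAt.eventually_mem ?_
    rw [h0]
    exact extChartAt_target_mem_nhds y
  have hsm : ∀ t, c t ∈ (extChartAt J y).target → ContMDiffAt 𝓘(ℝ, ℝ) J ∞ γ t := fun t ht =>
    ((contMDiffOn_extChartAt_symm y).contMDiffAt
      ((isOpen_extChartAt_target y).mem_nhds ht)).comp t hc.contMDiff.contMDiffAt
  refine Submodule.subset_span ⟨γ, hγ0, ?_, ?_⟩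
  · filter_upwards [htgt, hW] with t ht htW using ⟨hsm t ht, htW⟩
  · have hmd : MDifferentiableAt 𝓘(ℝ, ℝ) J γ 0 :=
      (hsm 0 htgt.self_of_nhds).mdifferentiableAt (by simp)
    have hev : writtenInExtChartAt 𝓘(ℝ, ℝ) J 0 γ =ᶠ[𝓝 0] c := by
      filter_upwards [htgt] with t ht
      simp only [writtenInExtChartAt, hγ0, Function.comp_apply]
      exact (extChartAt J y).right_inv ht
    rw [hmd.mfderiv]
    simp only [modelWithCornersSelf_coe, range_id, fderivWithin_univ]
    have : fderiv ℝ (writtenInExtChartAt 𝓘(ℝ, ℝ) J 0 γ) (extChartAt 𝓘(ℝ, ℝ) (0 : ℝ) 0) =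
        fderiv ℝ c 0 := hev.fderiv_eq
    rw [this]
    rfl

/-- `𝒜¹`-invariant sets are invariant under linear changes of coordinates. -/
theorem IsA1Invariant.comp_mem {n ℓ : ℕ} {X : Set (JetFiber n ℓ)} (hX : IsA1Invariant X)
    {L : JetFiber n ℓ} (hL : L ∈ X) (T : Euc ℓ ≃L[ℝ] Euc ℓ) (e : Euc n ≃L[ℝ] Euc n) :
    (T : Euc ℓ →L[ℝ] Euc ℓ) ∘L L ∘L (e : Euc n →L[ℝ] Euc n) ∈ X := by
  have hgerm : ∀ {k : ℕ} (S : Euc k ≃L[ℝ] Euc k),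
      IsDiffeoGermAtZero S.toHomeomorph.toOpenPartialHomeomorph := fun S =>
    ⟨mem_univ _, map_zero S, S.contDiff.contDiffOn, S.symm.contDiff.contDiffOn⟩
  have h := hX L (Filter.Eventually.of_forall fun x => L.contDiff.contDiffAt) (map_zero L)
    (by rwa [L.fderiv]) _ _ (hgerm T) (hgerm e.symm)
  have h2 : fderiv ℝ (fun x => T (L (e x))) 0 =
      (T : Euc ℓ →L[ℝ] Euc ℓ) ∘L L ∘L (e : Euc n →L[ℝ] Euc n) :=
    ((T : Euc ℓ →L[ℝ] Euc ℓ) ∘L L ∘L (e : Euc n →L[ℝ] Euc n)).fderiv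
  rw [← h2]
  exact h

theorem IsA1Invariant.comp_mem_iff {n ℓ : ℕ} {X : Set (JetFiber n ℓ)} (hX : IsA1Invariant X)
    {L : JetFiber n ℓ} (e : Euc n ≃L[ℝ] Euc n) :
    L ∘L (e : Euc n →L[ℝ] Euc n) ∈ X ↔ L ∈ X := by
  constructor
  · intro h
    have := hX.comp_mem h (ContinuousLinearEquiv.refl ℝ _) e.symm
    convert! this using 1
    ext1 v
    simp
  · intro h
    exact hX.comp_mem h (ContinuousLinearEquiv.refl ℝ _) e

section JetBundle

variable {n ℓ : ℕ} {N : Type*} [TopologicalSpace N] [ChartedSpace (Euc n) N]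
  [IsManifold (𝓡 n) ∞ N]

theorem trivializationAt_hom_apply_snd (q₀ : N) (z : JetBundle n ℓ N) :
    (trivializationAt (JetFiber n ℓ)
      (fun q : N => TangentSpace (𝓡 n) q →L[ℝ] Trivial N (Euc ℓ) q) q₀ z.1).2 =
      ContinuousLinearMap.comp (z.1.snd : Euc n →L[ℝ] Euc ℓ)
        ((trivializationAt (Euc n) (TangentSpace (𝓡 n) : N → Type _) q₀).symmL ℝ z.1.proj :
          Euc n →L[ℝ] Euc n) := by
  rw [hom_trivializationAt_apply]
  simp only [ContinuousLinearMap.inCoordinates]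
  erw [Bundle.Trivial.continuousLinearMapAt_trivialization]
  rfl

theorem extChartAt_jetBundle_apply (z₀ z : JetBundle n ℓ N) :
    extChartAt (jetModel n ℓ) z₀ z =
      ((extChartAt (𝓡 n) z₀.1.proj z.1.proj,
        ContinuousLinearMap.comp (z.1.snd : Euc n →L[ℝ] Euc ℓ)
          ((trivializationAt (Euc n) (TangentSpace (𝓡 n) : N → Type _) z₀.1.proj).symmL ℝ z.1.proj :
            Euc n →L[ℝ] Euc n)), z.2) := by
  rw [extChartAt_prod]
  simp only [PartialEquiv.prod_coe]
  rw [FiberBundle.extChartAt]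
  simp only [PartialEquiv.trans_apply, PartialEquiv.prod_coe]
  refine Prod.ext (Prod.ext rfl ?_) (by rw [extChartAt_model_space_eq_id]; rfl)
  exact trivializationAt_hom_apply_snd z₀.1.proj z

theorem exists_equiv_coe_eq_symmL {q₀ q : N} (hq : q ∈ (chartAt (Euc n) q₀).source) :
    ∃ e : Euc n ≃L[ℝ] Euc n, (e : Euc n →L[ℝ] Euc n) =
      (trivializationAt (Euc n) (TangentSpace (𝓡 n) : N → Type _) q₀).symmL ℝ q := by
  refine ⟨((trivializationAt (Euc n) (TangentSpace (𝓡 n) : N → Type _)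
    q₀).continuousLinearEquivAt ℝ q hq).symm, ?_⟩
  ext1 v
  exact congrFun (Trivialization.symm_continuousLinearEquivAt_eq _ hq) v

/-- Since `X` is invariant under linear changes of coordinates, membership in the subbundle does
not depend on the chart; it can be read off in the coordinates of `T_q N` that come from the
preferred chart at `q`. -/
theorem mem_jetSubbundle_iff {X : Set (JetFiber n ℓ)} (hX : IsA1Invariant X)
    (z : JetBundle n ℓ N) :
    z ∈ (jetSubbundle X : Set (JetBundle n ℓ N)) ↔ (z.1.snd : Euc n →L[ℝ] Euc ℓ) ∈ X := by
  have key : ∀ φ ∈ atlas (Euc n) N, JetBundle.source z ∈ φ.source →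
      ∃ e : Euc n ≃L[ℝ] Euc n, (e : Euc n →L[ℝ] Euc n) =
        mfderiv (𝓡 n) (𝓡 n) φ.symm (φ (JetBundle.source z)) := by
    intro φ hφ hz
    have h1 := (mdifferentiable_of_mem_atlas (I := 𝓡 n) hφ).symm
    exact ⟨h1.mfderiv (x := φ (JetBundle.source z)) (φ.map_source hz), rfl⟩
  constructor
  · rintro ⟨φ, hφ, hz, hmem⟩
    obtain ⟨e, he⟩ := key φ hφ hz
    refine (hX.comp_mem_iff e).1 ?_
    rw [he]
    exact hmem
  · intro h
    obtain ⟨e, he⟩ := key _ (chart_mem_atlas (Euc n) (JetBundle.source z))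
      (mem_chart_source (Euc n) (JetBundle.source z))
    refine ⟨_, chart_mem_atlas (Euc n) (JetBundle.source z), mem_chart_source _ _, ?_⟩
    rw [jetInChart, ← he]
    exact (hX.comp_mem_iff e).2 h

theorem mem_jetSubbundle_iff_extChartAt {X : Set (JetFiber n ℓ)} (hX : IsA1Invariant X)
    {z₀ z : JetBundle n ℓ N} (hz : z.1.proj ∈ (chartAt (Euc n) z₀.1.proj).source) :
    z ∈ (jetSubbundle X : Set (JetBundle n ℓ N)) ↔ (extChartAt (jetModel n ℓ) z₀ z).1.2 ∈ X := by
  rw [mem_jetSubbundle_iff hX, extChartAt_jetBundle_apply]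
  obtain ⟨e, he⟩ := exists_equiv_coe_eq_symmL hz
  simp only [← he]
  exact (hX.comp_mem_iff e).symm

theorem proj_mem_of_mem_extChartAt_source {z₀ z : JetBundle n ℓ N}
    (hz : z ∈ (extChartAt (jetModel n ℓ) z₀).source) :
    z.1.proj ∈ (chartAt (Euc n) z₀.1.proj).source := by
  rw [extChartAt_prod, FiberBundle.extChartAt] at hz
  have := hz.1.1
  exact ((trivializationAt (Euc n →L[ℝ] Euc ℓ)
    (fun x => TangentSpace (𝓡 n) x →L[ℝ] Trivial N (Euc ℓ) x) z₀.1.proj).mem_source.1 this).1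

theorem eventually_add_smul_mem_range_equiv {k : ℕ} (A : Euc k →L[ℝ] Euc k) :
    ∀ᶠ t in 𝓝 (0 : ℝ), ∃ e : Euc k ≃L[ℝ] Euc k,
      (e : Euc k →L[ℝ] Euc k) = ContinuousLinearMap.id ℝ (Euc k) + t • A := by
  have hc : Continuous fun t : ℝ => ContinuousLinearMap.id ℝ (Euc k) + t • A := by fun_prop
  refine hc.continuousAt.eventually_mem (s := range (fun e : Euc k ≃L[ℝ] Euc k =>
    (e : Euc k →L[ℝ] Euc k))) ?_
  have h0 : ContinuousLinearMap.id ℝ (Euc k) + (0 : ℝ) • A = ContinuousLinearMap.id ℝ (Euc k) := by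
    ext1 v
    simp
  rw [h0]
  exact ContinuousLinearEquiv.nhds (ContinuousLinearEquiv.refl ℝ (Euc k))

/-- The curves `t ↦ (x + t v, (1 + t A) L (1 + t B), y + t w)` stay in the subbundle. -/
theorem mem_tangentSpaceOf_jetSubbundle {X : Set (JetFiber n ℓ)} (hX : IsA1Invariant X)
    {z₀ : JetBundle n ℓ N} (hz₀ : z₀ ∈ (jetSubbundle X : Set (JetBundle n ℓ N)))
    (v : Euc n) (w : Euc ℓ) (A : Euc ℓ →L[ℝ] Euc ℓ) (B : Euc n →L[ℝ] Euc n) :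
    ((v, A ∘L (extChartAt (jetModel n ℓ) z₀ z₀).1.2 + (extChartAt (jetModel n ℓ) z₀ z₀).1.2 ∘L B),
      w) ∈ tangentSpaceOf (jetModel n ℓ) (jetSubbundle X : Set (JetBundle n ℓ N)) z₀ := by
  set b := extChartAt (jetModel n ℓ) z₀ z₀
  set L : Euc n →L[ℝ] Euc ℓ := b.1.2
  set c : ℝ → (Euc n × JetFiber n ℓ) × Euc ℓ := fun t =>
    ((b.1.1 + t • v, (ContinuousLinearMap.id ℝ _ + t • A) ∘L L ∘L
      (ContinuousLinearMap.id ℝ _ + t • B)), b.2 + t • w)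
  have hc : ContDiff ℝ ∞ c := by
    refine ContDiff.prodMk (ContDiff.prodMk (by fun_prop) ?_) (by fun_prop)
    exact ContDiff.clm_comp (by fun_prop) (ContDiff.clm_comp (by fun_prop) (by fun_prop))
  have hc0 : c 0 = b := by
    refine Prod.ext (Prod.ext (by simp [c]) ?_) (by simp [c])
    ext1 u
    simp [c, L]
  have hder : HasDerivAt c ((v, A ∘L L + L ∘L B), w) 0 := by
    have d0 : ∀ {F : Type} [NormedAddCommGroup F] [NormedSpace ℝ F] (a u : F),
        HasDerivAt (fun t : ℝ => a + t • u) u 0 := fun a u => by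
      simpa using ((hasDerivAt_id (0 : ℝ)).smul_const u).const_add a
    refine HasDerivAt.prodMk (HasDerivAt.prodMk (d0 _ _) ?_) (d0 _ _)
    have h1 := (d0 (ContinuousLinearMap.id ℝ (Euc ℓ)) A).clm_comp
      ((hasDerivAt_const (0 : ℝ) L).clm_comp (d0 (ContinuousLinearMap.id ℝ (Euc n)) B))
    convert! h1 using 1
    ext1 u
    simp
  rw [← hder.deriv]
  refine deriv_mem_tangentSpaceOf hc hc0 ?_
  have htgt : ∀ᶠ t in 𝓝 (0 : ℝ), c t ∈ (extChartAt (jetModel n ℓ) z₀).target := by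
    refine hc.continuous.continuousAt.eventually_mem ?_
    rw [hc0]
    exact extChartAt_target_mem_nhds z₀
  filter_upwards [htgt, eventually_add_smul_mem_range_equiv A,
    eventually_add_smul_mem_range_equiv B] with t ht ⟨eA, heA⟩ ⟨eB, heB⟩
  rw [mem_jetSubbundle_iff_extChartAt hX (proj_mem_of_mem_extChartAt_source
    ((extChartAt (jetModel n ℓ) z₀).map_target ht)), (extChartAt (jetModel n ℓ) z₀).right_inv ht]
  have hL : L ∈ X := (mem_jetSubbundle_iff_extChartAt hX (mem_chart_source _ _)).1 hz₀
  change (ContinuousLinearMap.id ℝ _ + t • A) ∘L L ∘L (ContinuousLinearMap.id ℝ _ + t • B) ∈ X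
  rw [← heA, ← heB]
  exact hX.comp_mem hL eA eB

end JetBundle

/-! ### The 1-jet extension in charts -/

section JetExtension

variable {n ℓ : ℕ} {N : Type*} [TopologicalSpace N] [ChartedSpace (Euc n) N]
  [IsManifold (𝓡 n) ∞ N]

theorem contDiffOn_comp_extChartAt_symm {k : ℕ} {g : N → Euc k}
    (hg : ContMDiff (𝓡 n) (𝓡 k) ∞ g) (q₀ : N) :
    ContDiffOn ℝ ∞ (g ∘ (extChartAt (𝓡 n) q₀).symm) (extChartAt (𝓡 n) q₀).target :=
  contMDiffOn_iff_contDiffOn.1 (hg.comp_contMDiffOn (contMDiffOn_extChartAt_symm q₀))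

theorem fderiv_comp_extChartAt_symm {k : ℕ} {g : N → Euc k}
    (hg : ContMDiff (𝓡 n) (𝓡 k) ∞ g) {q₀ q : N} (hq : q ∈ (extChartAt (𝓡 n) q₀).source) :
    fderiv ℝ (g ∘ (extChartAt (𝓡 n) q₀).symm) (extChartAt (𝓡 n) q₀ q) =
      ContinuousLinearMap.comp (mfderiv (𝓡 n) (𝓡 k) g q : Euc n →L[ℝ] Euc k)
        ((trivializationAt (Euc n) (TangentSpace (𝓡 n) : N → Type _) q₀).symmL ℝ q :
          Euc n →L[ℝ] Euc n) := by
  have hq' : q ∈ (chartAt (Euc n) q₀).source := by simpa using hq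
  rw [TangentBundle.symmL_trivializationAt hq']
  have h1 := (mdifferentiableWithinAt_extChartAt_symm (I := 𝓡 n)
    ((extChartAt (𝓡 n) q₀).map_source hq)).hasMFDerivWithinAt
  have h2 : HasMFDerivAt (𝓡 n) (𝓡 k) g
      ((extChartAt (𝓡 n) q₀).symm (extChartAt (𝓡 n) q₀ q))
      (mfderiv (𝓡 n) (𝓡 k) g q) := by
    rw [(extChartAt (𝓡 n) q₀).left_inv hq]
    exact (hg.mdifferentiable (by simp) q).hasMFDerivAt
  have h3 := h2.comp_hasMFDerivWithinAt _ h1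
  rw [ModelWithCorners.range_eq_univ] at h3 ⊢
  have h4 : ∀ D : Euc n →L[ℝ] Euc k,
      HasFDerivWithinAt (g ∘ (extChartAt (𝓡 n) q₀).symm) D univ (extChartAt (𝓡 n) q₀ q) →
      fderiv ℝ (g ∘ (extChartAt (𝓡 n) q₀).symm) (extChartAt (𝓡 n) q₀ q) = D :=
    fun D hD => (hasFDerivWithinAt_univ.1 hD).fderiv
  exact h4 _ (hasMFDerivWithinAt_iff_hasFDerivWithinAt.1 h3)

theorem extChartAt_jet1 {g : N → Euc ℓ} (hg : ContMDiff (𝓡 n) (𝓡 ℓ) ∞ g) {q₀ q : N}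
    (hq : q ∈ (extChartAt (𝓡 n) q₀).source) :
    extChartAt (jetModel n ℓ) (jet1 g q₀ : JetBundle n ℓ N) (jet1 g q) =
      ((extChartAt (𝓡 n) q₀ q,
        fderiv ℝ (g ∘ (extChartAt (𝓡 n) q₀).symm) (extChartAt (𝓡 n) q₀ q)), g q) := by
  rw [extChartAt_jetBundle_apply, fderiv_comp_extChartAt_symm hg hq]
  rfl

theorem mdifferentiableAt_jet1 {g : N → Euc ℓ} (hg : ContMDiff (𝓡 n) (𝓡 ℓ) ∞ g) (q₀ : N) :
    MDifferentiableAt (𝓡 n) (jetModel n ℓ) (jet1 g : N → JetBundle n ℓ N) q₀ := by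
  refine MDifferentiableAt.prodMk ?_ (hg.mdifferentiable (by simp) q₀)
  refine (mdifferentiableAt_totalSpace (𝓡 n)
    (fun q => (jet1 g q : JetBundle n ℓ N).1)).2 ⟨mdifferentiableAt_id, ?_⟩
  have hev : (fun q => (trivializationAt (JetFiber n ℓ)
      (fun q : N => TangentSpace (𝓡 n) q →L[ℝ] Trivial N (Euc ℓ) q) q₀
        (jet1 g q : JetBundle n ℓ N).1).2) =ᶠ[𝓝 q₀] fun q =>
      fderiv ℝ (g ∘ (extChartAt (𝓡 n) q₀).symm) (extChartAt (𝓡 n) q₀ q) := by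
    filter_upwards [extChartAt_source_mem_nhds (I := 𝓡 n) q₀] with q hq
    rw [trivializationAt_hom_apply_snd, fderiv_comp_extChartAt_symm hg hq]
    rfl
  refine MDifferentiableAt.congr_of_eventuallyEq ?_ hev
  have h1 : ContDiffAt ℝ ∞ (g ∘ (extChartAt (𝓡 n) q₀).symm) (extChartAt (𝓡 n) q₀ q₀) :=
    (contDiffOn_comp_extChartAt_symm hg q₀).contDiffAt (extChartAt_target_mem_nhds q₀)
  have h2 := (h1.fderiv_right (m := 1) (by norm_cast)).contMDiffAt.comp q₀
    (contMDiffAt_extChartAt (I := 𝓡 n) (n := 1))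
  exact h2.mdifferentiableAt one_ne_zero

/-- In the preferred charts at `q₀` and at `j^1 g (q₀)`, the jet extension is the map
`x ↦ (x, dh_x, h x)`, where `h` is the expression of `g`. -/
theorem mfderiv_jet1_apply {g : N → Euc ℓ} (hg : ContMDiff (𝓡 n) (𝓡 ℓ) ∞ g) (q₀ : N)
    (v : Euc n) :
    (mfderiv (𝓡 n) (jetModel n ℓ) (jet1 g : N → JetBundle n ℓ N) q₀ v :
      (Euc n × JetFiber n ℓ) × Euc ℓ) =
      ((v, fderiv ℝ (fderiv ℝ (g ∘ (extChartAt (𝓡 n) q₀).symm)) (extChartAt (𝓡 n) q₀ q₀) v),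
        fderiv ℝ (g ∘ (extChartAt (𝓡 n) q₀).symm) (extChartAt (𝓡 n) q₀ q₀) v) := by
  set h := g ∘ (extChartAt (𝓡 n) q₀).symm
  set x₀ := extChartAt (𝓡 n) q₀ q₀
  have hh : ContDiffAt ℝ ∞ h x₀ :=
    (contDiffOn_comp_extChartAt_symm hg q₀).contDiffAt (extChartAt_target_mem_nhds q₀)
  have hev : writtenInExtChartAt (𝓡 n) (jetModel n ℓ) q₀ (jet1 g : N → JetBundle n ℓ N)
      =ᶠ[𝓝 x₀] fun x => ((x, fderiv ℝ h x), h x) := by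
    filter_upwards [extChartAt_target_mem_nhds (I := 𝓡 n) q₀] with x hx
    have := extChartAt_jet1 hg ((extChartAt (𝓡 n) q₀).map_target hx)
    rw [(extChartAt (𝓡 n) q₀).right_inv hx] at this
    exact this
  have hd : HasFDerivAt (fun x => ((x, fderiv ℝ h x), h x))
      (((ContinuousLinearMap.id ℝ _).prod (fderiv ℝ (fderiv ℝ h) x₀)).prod (fderiv ℝ h x₀)) x₀ :=
    ((hasFDerivAt_id x₀).prodMk ((hh.fderiv_right (m := 1) (by norm_cast)).differentiableAt
      one_ne_zero).hasFDerivAt).prodMk (hh.differentiableAt (by simp)).hasFDerivAt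
  rw [(mdifferentiableAt_jet1 hg q₀).mfderiv]
  rw [ModelWithCorners.range_eq_univ, fderivWithin_univ, hev.fderiv_eq, hd.fderiv]
  rfl

theorem isTransverseAt_jet1 {X : Set (JetFiber n ℓ)} (hX : IsA1Invariant X) {g : N → Euc ℓ}
    (hg : ContMDiff (𝓡 n) (𝓡 ℓ) ∞ g) {q₀ : N}
    (H : OrbitTransverseAt (g ∘ (extChartAt (𝓡 n) q₀).symm) (extChartAt (𝓡 n) q₀ q₀)) :
    IsTransverseAt (𝓡 n) (jetModel n ℓ) (jet1 g) (jetSubbundle X : Set (JetBundle n ℓ N)) q₀ := by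
  intro hmem
  rw [eq_top_iff]
  rintro ⟨⟨v₀, T₀⟩, w₀⟩ -
  obtain ⟨v, A, B, hT⟩ := H T₀
  have hL : (extChartAt (jetModel n ℓ) (jet1 g q₀ : JetBundle n ℓ N) (jet1 g q₀)).1.2 =
      fderiv ℝ (g ∘ (extChartAt (𝓡 n) q₀).symm) (extChartAt (𝓡 n) q₀ q₀) := by
    rw [extChartAt_jet1 hg (mem_extChartAt_source q₀)]
  have h1 := mem_tangentSpaceOf_jetSubbundle hX hmem (v₀ - v)
    (w₀ - fderiv ℝ (g ∘ (extChartAt (𝓡 n) q₀).symm) (extChartAt (𝓡 n) q₀ q₀) v) A B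
  rw [hL] at h1
  have h2 := mfderiv_jet1_apply hg q₀ v
  refine Submodule.mem_sup.2 ⟨_, ⟨v, rfl⟩, _, h1, ?_⟩
  refine (congrArg (fun z : (Euc n × JetFiber n ℓ) × Euc ℓ => z + _) h2).trans ?_
  refine Prod.ext (Prod.ext ?_ ?_) ?_
  · simp
  · simp only [Prod.fst_add, Prod.snd_add]
    rw [hT, add_assoc]
  · simp

end JetExtension

/-- For almost all `p` the 1-jet extension of `G_p ∘ f` is transverse to all invariant subbundles at
once, because it is transverse to all orbits. Countably many charts suffice to test this, as
`OrbitTransverseAt` is preserved by coordinate changes. -/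
theorem ae_isTransverse_jet1 {n m ℓ : ℕ} {N : Type*} [TopologicalSpace N]
    [SecondCountableTopology N] [ChartedSpace (Euc n) N] [IsManifold (𝓡 n) ∞ N] {f : N → Euc m}
    {A : Matrix (Fin ℓ) (Fin m) ℝ} (hA : ∀ i j, A i j ≠ 0)
    (hf : IsSmoothImmersion (𝓡 n) (𝓡 m) f) :
    ∀ᵐ p : Fin ℓ → Euc m, ∀ X : Set (JetFiber n ℓ), IsA1Invariant X →
      IsTransverse (𝓡 n) (jetModel n ℓ) (jet1 (genDistSq p A ∘ f))
        (jetSubbundle X : Set (JetBundle n ℓ N)) := by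
  obtain ⟨t, htc, ht⟩ := TopologicalSpace.countable_cover_nhds
    (fun q : N => extChartAt_source_mem_nhds (I := 𝓡 n) q)
  have hchart : ∀ q : N, ∀ᵐ p : Fin ℓ → Euc m, ∀ y ∈ (extChartAt (𝓡 n) q).target,
      OrbitTransverseAt (genDistSq p A ∘ f ∘ (extChartAt (𝓡 n) q).symm) y := by
    intro q
    refine ae_orbitTransverseAt_genDistSq_comp hA (isOpen_extChartAt_target q)
      (contDiffOn_comp_extChartAt_symm hf.1 q) fun y hy => ?_
    have hq := (extChartAt (𝓡 n) q).map_target hy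
    have := fderiv_comp_extChartAt_symm hf.1 hq
    rw [(extChartAt (𝓡 n) q).right_inv hy] at this
    have hq' : (extChartAt (𝓡 n) q).symm y ∈ (chartAt (Euc n) q).source := by
      rwa [extChartAt_source] at hq
    obtain ⟨e, he⟩ := exists_equiv_coe_eq_symmL hq'
    rw [this, ← he]
    exact (hf.2 _).comp e.injective
  filter_upwards [(ae_ball_iff htc).2 fun q _ => hchart q] with p hp X hX q₀
  have hg : ContMDiff (𝓡 n) (𝓡 ℓ) ∞ (genDistSq p A ∘ f) :=
    (contDiff_genDistSq p A).contMDiff.comp hf.1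
  refine isTransverseAt_jet1 hX hg ?_
  obtain ⟨q, hqt, hq⟩ := mem_iUnion₂.1 (ht.symm ▸ mem_univ q₀)
  -- the preferred chart at `q₀` differs from that at `q` by the coordinate change `τ`
  set τ : Euc n → Euc n := extChartAt (𝓡 n) q ∘ (extChartAt (𝓡 n) q₀).symm
  have hq₀ := mem_extChartAt_source (I := 𝓡 n) q₀
  have hτq : τ (extChartAt (𝓡 n) q₀ q₀) = extChartAt (𝓡 n) q q₀ := by
    simp [τ]
  have h1 := hp q hqt (τ (extChartAt (𝓡 n) q₀ q₀)) (by
    rw [hτq]; exact (extChartAt (𝓡 n) q).map_source hq)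
  have hτ : ContDiffAt ℝ ∞ τ (extChartAt (𝓡 n) q₀ q₀) := by
    have := contDiffWithinAt_ext_coord_change (I := 𝓡 n) (n := ∞) q q₀
      (y := extChartAt (𝓡 n) q₀ q₀) (by simpa using hq)
    rwa [ModelWithCorners.range_eq_univ, contDiffWithinAt_univ] at this
  have hτ' : HasFDerivAt τ (tangentCoordChange (𝓡 n) q₀ q q₀) (extChartAt (𝓡 n) q₀ q₀) := by
    have := hasFDerivWithinAt_tangentCoordChange (I := 𝓡 n) (x := q₀) (y := q) (z := q₀) ⟨hq₀, hq⟩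
    rwa [ModelWithCorners.range_eq_univ, hasFDerivWithinAt_univ] at this
  have hinv : ∀ {a b : N}, q₀ ∈ (extChartAt (𝓡 n) a).source → q₀ ∈ (extChartAt (𝓡 n) b).source →
      Function.LeftInverse (tangentCoordChange (𝓡 n) b a q₀) (tangentCoordChange (𝓡 n) a b q₀) :=
    fun ha hb v => by rw [tangentCoordChange_comp ⟨⟨ha, hb⟩, ha⟩, tangentCoordChange_self ha]
  set e : Euc n ≃L[ℝ] Euc n := ContinuousLinearEquiv.equivOfInverse
    (tangentCoordChange (𝓡 n) q₀ q q₀) (tangentCoordChange (𝓡 n) q q₀ q₀)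
    (hinv hq₀ hq) (hinv hq hq₀)
  have h2 := h1.comp (τ := τ) (((contDiffOn_comp_extChartAt_symm hg q).contDiffAt
    ((isOpen_extChartAt_target q).mem_nhds (by
      rw [hτq]; exact (extChartAt (𝓡 n) q).map_source hq)))) hτ e (by rw [hτ'.fderiv]; rfl)
  refine h2.congr ?_
  have hcont : ContinuousAt (extChartAt (𝓡 n) q₀).symm (extChartAt (𝓡 n) q₀ q₀) :=
    continuousAt_extChartAt_symm q₀
  have hmem : ∀ᶠ x in 𝓝 (extChartAt (𝓡 n) q₀ q₀),
      (extChartAt (𝓡 n) q₀).symm x ∈ (extChartAt (𝓡 n) q).source := by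
    refine hcont.eventually_mem ?_
    rw [extChartAt_to_inv]
    exact (isOpen_extChartAt_source q).mem_nhds hq
  filter_upwards [hmem] with x hx
  simp only [Function.comp_apply, τ]
  rw [(extChartAt (𝓡 n) q).left_inv hx]

/-! ### Multiple points -/

/-- For almost all `p`, no multiple point of `G_p ∘ f` at points in general position admits a
nonzero covector `μ` that annihilates the differentials: `(y, μ)` would be a critical zero of
`∑ i, ⟪μ i, g (y (i + 1)) - g (y 0)⟫`, which is affine in `p`. The maps `F i` are the expressions of
`f` in charts around the points of the tuple. -/
theorem ae_covector_eq_zero {n m ℓ k : ℕ} {A : Matrix (Fin ℓ) (Fin m) ℝ}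
    (hA : ∀ i j, A i j ≠ 0) {F : Fin (k + 1) → Euc n → Euc m} {O : Fin (k + 1) → Set (Euc n)}
    (hO : ∀ i, IsOpen (O i)) (hF : ∀ i, ContDiffOn ℝ ∞ (F i) (O i)) :
    ∀ᵐ p : Fin ℓ → Euc m, ∀ y : Fin (k + 1) → Euc n, (∀ i, y i ∈ O i) →
      LinearIndependent ℝ (fun i : Fin k => F i.succ (y i.succ) - F 0 (y 0)) →
      (∀ i : Fin k, genDistSq p A (F i.succ (y i.succ)) = genDistSq p A (F 0 (y 0))) →
      ∀ μ : Fin k → Euc ℓ,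
        (∀ (i : Fin k) v, inner ℝ (μ i) (fderiv ℝ (genDistSq p A ∘ F i.succ) (y i.succ) v) = 0) →
        (∀ v, inner ℝ (∑ i, μ i) (fderiv ℝ (genDistSq p A ∘ F 0) (y 0) v) = 0) → μ = 0 := by
  set O' : Set ((Fin (k + 1) → Euc n) × (Fin k → Euc ℓ)) := {x | ∀ i, x.1 i ∈ O i}
  have hO' : IsOpen O' := by
    simp only [O', ofPred_forall]
    exact isOpen_iInter_of_finite fun i => (hO i).preimage (by fun_prop)
  have hFc : ∀ i j, ContDiffOn ℝ ∞
      (fun x : (Fin (k + 1) → Euc n) × (Fin k → Euc ℓ) => F i (x.1 i) j) O' := fun i j =>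
    contDiffOn_euclidean.1 (ContDiffOn.comp (s := O') (hF i)
      (f := fun x : (Fin (k + 1) → Euc n) × (Fin k → Euc ℓ) => x.1 i) (by fun_prop)
      fun x hx => hx i) j
  have hμc : ∀ i l, ContDiffOn ℝ ∞
      (fun x : (Fin (k + 1) → Euc n) × (Fin k → Euc ℓ) => x.2 i l) O' := fun i l => by fun_prop
  have hae := ae_fderiv_affine_family_points_ne_zero (ℓ := ℓ) (m := m) hO'
    (a := fun x => ∑ l, ∑ j, ∑ i : Fin k, x.2 i l *
      (A l j * (F i.succ (x.1 i.succ) j ^ 2 - F 0 (x.1 0) j ^ 2)))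
    (c := fun l j x => -2 * A l j * ∑ i : Fin k, x.2 i l *
      (F i.succ (x.1 i.succ) j - F 0 (x.1 0) j))
    (ContDiffOn.sum fun l _ => ContDiffOn.sum fun j _ => ContDiffOn.sum fun i _ =>
      (hμc i l).mul (contDiffOn_const.mul (((hFc _ _).pow 2).sub ((hFc _ _).pow 2))))
    (fun l j => contDiffOn_const.mul (ContDiffOn.sum fun i _ =>
      (hμc i l).mul ((hFc _ _).sub (hFc _ _))))
  filter_upwards [hae] with p hp y hy hli hval μ hμ hμ0
  by_contra hne
  set g : Fin (k + 1) → Euc n → Euc ℓ := fun i => genDistSq p A ∘ F i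
  have hg : ∀ i, HasFDerivAt (g i) (fderiv ℝ (g i) (y i)) (y i) := fun i =>
    (((contDiff_genDistSq p A).contDiffAt.comp (y i)
      ((hF i).contDiffAt ((hO i).mem_nhds (hy i)))).differentiableAt (by simp)).hasFDerivAt
  have heq : ∀ x : (Fin (k + 1) → Euc n) × (Fin k → Euc ℓ),
      (∑ l, ∑ j, ∑ i : Fin k, x.2 i l *
        (A l j * (F i.succ (x.1 i.succ) j ^ 2 - F 0 (x.1 0) j ^ 2))) +
      ∑ l, ∑ j, (-2 * A l j * ∑ i : Fin k, x.2 i l *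
        (F i.succ (x.1 i.succ) j - F 0 (x.1 0) j)) * p l j =
      ∑ i : Fin k, inner ℝ (x.2 i) (g i.succ (x.1 i.succ) - g 0 (x.1 0)) := by
    intro x
    simp only [PiLp.inner_apply, g, genDistSq, Function.comp_apply, PiLp.sub_apply]
    rw [Finset.sum_comm (s := (Finset.univ : Finset (Fin k))), ← Finset.sum_add_distrib]
    refine Finset.sum_congr rfl fun l _ => ?_
    rw [← Finset.sum_add_distrib]
    simp only [← Finset.sum_sub_distrib, RCLike.inner_apply, conj_trivial, Finset.sum_mul]
    rw [Finset.sum_comm (s := (Finset.univ : Finset (Fin k)))]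
    refine Finset.sum_congr rfl fun j _ => ?_
    rw [Finset.mul_sum, Finset.sum_mul, ← Finset.sum_add_distrib]
    refine Finset.sum_congr rfl fun i _ => ?_
    ring
  refine hp (y, μ) hy ?_ ?_ ?_
  · obtain ⟨i, hi⟩ : ∃ i, μ i ≠ 0 := by
      by_contra! h0
      exact hne (funext h0)
    obtain ⟨l, hl⟩ : ∃ l, μ i l ≠ 0 := by
      by_contra! h0
      exact hi (by ext l; simpa using h0 l)
    by_contra! h0
    refine hl (Fintype.linearIndependent_iff.1 hli (fun i => μ i l) ?_ i)
    ext j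
    have h1 := (mul_eq_zero.1 (h0 l j)).resolve_left (mul_ne_zero (by norm_num) (hA l j))
    simpa [Finset.sum_apply] using h1
  · rw [heq]
    refine Finset.sum_eq_zero fun i _ => ?_
    simp only [g, Function.comp_apply, hval, sub_self, inner_zero_right]
  · simp only [heq]
    have d1 : ∀ i, HasFDerivAt (fun x : (Fin (k + 1) → Euc n) × (Fin k → Euc ℓ) => g i (x.1 i))
        ((fderiv ℝ (g i) (y i)).comp ((ContinuousLinearMap.proj i).comp
          (ContinuousLinearMap.fst ℝ _ _))) (y, μ) := fun i =>
      HasFDerivAt.comp (y, μ) (hg i) (((ContinuousLinearMap.proj i).comp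
          (ContinuousLinearMap.fst ℝ (Fin (k + 1) → Euc n) (Fin k → Euc ℓ))).hasFDerivAt)
    have d2 : ∀ i, HasFDerivAt (fun x : (Fin (k + 1) → Euc n) × (Fin k → Euc ℓ) => x.2 i)
        ((ContinuousLinearMap.proj i).comp (ContinuousLinearMap.snd ℝ _ _)) (y, μ) := fun i =>
      ((ContinuousLinearMap.proj i).comp
          (ContinuousLinearMap.snd ℝ (Fin (k + 1) → Euc n) (Fin k → Euc ℓ))).hasFDerivAt
    have d3 := HasFDerivAt.fun_sum (u := Finset.univ) fun (i : Fin k) _ =>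
      (d2 i).inner ℝ ((d1 i.succ).sub (d1 0))
    refine d3.fderiv.trans (ContinuousLinearMap.ext fun ⟨δy, δμ⟩ => ?_)
    have hval' : ∀ i : Fin k, g i.succ (y i.succ) = g 0 (y 0) := hval
    simp only [sum_inner] at hμ0
    simp [fderivInnerCLM_apply, hval', inner_sub_right, Finset.sum_sub_distrib]
    simp [g, hμ, hμ0]

section MultiMap

variable {n ℓ : ℕ} {N : Type*} [TopologicalSpace N] [T2Space N] [ChartedSpace (Euc n) N]
  [IsManifold (𝓡 n) ∞ N]

theorem mfderiv_multiMap_apply {s : ℕ} {g : N → Euc ℓ} (hg : ContMDiff (𝓡 n) (𝓡 ℓ) ∞ g)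
    (q : distinctTuples N s) (v : Fin s → Euc n) :
    (mfderiv (ModelWithCorners.pi fun _ : Fin s => 𝓡 n) 𝓘(ℝ, Fin s → Euc ℓ) (multiMap s g) q v :
      Fin s → Euc ℓ) = fun i => mfderiv (𝓡 n) (𝓡 ℓ) g (q.1 i) (v i) := by
  set I := ModelWithCorners.pi fun _ : Fin s => 𝓡 n
  have hrange : range I = univ := eq_univ_of_forall fun x => ⟨x, rfl⟩
  set x₀ := extChartAt I q q
  have hx₀ : ∀ i, x₀ i = extChartAt (𝓡 n) (q.1 i) (q.1 i) := fun i => rfl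
  have hev : writtenInExtChartAt I 𝓘(ℝ, Fin s → Euc ℓ) q (multiMap s g) =ᶠ[𝓝 x₀]
      fun x i => (g ∘ (extChartAt (𝓡 n) (q.1 i)).symm) (x i) := by
    have htgt : (extChartAt I q).target ∈ 𝓝 x₀ := by
      have := extChartAt_target_mem_nhdsWithin (I := I) q
      rwa [hrange, nhdsWithin_univ] at this
    filter_upwards [htgt] with x hx
    rw [extChartAt_target] at hx
    have h1 := (chartAt (ModelPi fun _ : Fin s => Euc n) q.1).subtypeRestr_symm_apply ⟨q⟩
      (y := I.symm x) hx.1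
    exact funext fun i => congrArg g (congrFun h1 i)
  have hd : HasFDerivAt (fun (x : Fin s → Euc n) i => (g ∘ (extChartAt (𝓡 n) (q.1 i)).symm) (x i))
      (ContinuousLinearMap.pi fun i => (fderiv ℝ (g ∘ (extChartAt (𝓡 n) (q.1 i)).symm)
        (extChartAt (𝓡 n) (q.1 i) (q.1 i))).comp (ContinuousLinearMap.proj i)) x₀ := by
    rw [hasFDerivAt_pi]
    intro i
    refine HasFDerivAt.comp (g := g ∘ (extChartAt (𝓡 n) (q.1 i)).symm) x₀ ?_
      (ContinuousLinearMap.proj (R := ℝ) (φ := fun _ : Fin s => Euc n) i).hasFDerivAt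
    exact (((contDiffOn_comp_extChartAt_symm hg (q.1 i)).contDiffAt
      (extChartAt_target_mem_nhds (q.1 i))).differentiableAt (by simp)).hasFDerivAt
  have hcont : Continuous (multiMap s g) := continuous_pi fun i =>
    hg.continuous.comp ((continuous_apply i).comp continuous_subtype_val)
  have hmd : MDifferentiableAt I 𝓘(ℝ, Fin s → Euc ℓ) (multiMap s g) q := by
    rw [mdifferentiableAt_iff]
    exact ⟨hcont.continuousAt, (hd.congr_of_eventuallyEq hev).differentiableAt.differentiableWithinAt⟩
  have hcomp : ∀ i, (mfderiv (𝓡 n) (𝓡 ℓ) g (q.1 i) : Euc n →L[ℝ] Euc ℓ) =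
      fderiv ℝ (g ∘ (extChartAt (𝓡 n) (q.1 i)).symm) (extChartAt (𝓡 n) (q.1 i) (q.1 i)) := by
    intro i
    rw [(hg.mdifferentiable (by simp) (q.1 i)).mfderiv, ModelWithCorners.range_eq_univ,
      fderivWithin_univ]
    rfl
  rw [hmd.mfderiv, hrange, fderivWithin_univ, hev.fderiv_eq, hd.fderiv]
  exact funext fun i => (congrArg (fun D : Euc n →L[ℝ] Euc ℓ => D (v i)) (hcomp i)).symm

/-- A multiple point where `g^{(s)}` is not transverse to the diagonal has a nonzero covector that
annihilates the differentials. The component at the first point is minus the sum of the others,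
since the covector also annihilates the diagonal. -/
theorem exists_covector_of_not_transverse {k : ℕ} {g : N → Euc ℓ}
    (hg : ContMDiff (𝓡 n) (𝓡 ℓ) ∞ g) {q : distinctTuples N (k + 1)}
    (H : ¬ IsTransverseAt (ModelWithCorners.pi fun _ : Fin (k + 1) => 𝓡 n)
      𝓘(ℝ, Fin (k + 1) → Euc ℓ) (multiMap (k + 1) g) (diagonalSet (Euc ℓ) (k + 1)) q) :
    (∀ i : Fin k, g (q.1 i.succ) = g (q.1 0)) ∧ ∃ μ : Fin k → Euc ℓ, μ ≠ 0 ∧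
      (∀ (i : Fin k) (v : Euc n),
        inner ℝ (μ i) (mfderiv (𝓡 n) (𝓡 ℓ) g (q.1 i.succ) v : Euc ℓ) = 0) ∧
      ∀ v : Euc n, inner ℝ (∑ i, μ i) (mfderiv (𝓡 n) (𝓡 ℓ) g (q.1 0) v : Euc ℓ) = 0 := by
  unfold IsTransverseAt at H
  push Not at H
  obtain ⟨hmem, hne⟩ := H
  obtain ⟨y, hy⟩ := id hmem
  have hyi : ∀ i, y = g (q.1 i) := fun i => congrFun hy i
  refine ⟨fun i => (hyi _).symm.trans (hyi 0), ?_⟩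
  obtain ⟨f, hf0, hf⟩ := Submodule.exists_le_ker_of_lt_top _ (lt_top_iff_ne_top.2 hne)
  set f' : (Fin (k + 1) → Euc ℓ) →ₗ[ℝ] ℝ := f
  set ν : Fin (k + 1) → Euc ℓ := fun i => (InnerProductSpace.toDual ℝ (Euc ℓ)).symm
    (LinearMap.toContinuousLinearMap (f' ∘ₗ LinearMap.single ℝ (fun _ => Euc ℓ) i))
  have hν : ∀ i u, inner ℝ (ν i) u = f' (Pi.single i u) := fun i u => by
    simp [ν, InnerProductSpace.toDual_symm_apply]
  have hsingle : ∀ w : Fin (k + 1) → Euc ℓ, f' w = ∑ i, inner ℝ (ν i) (w i) := fun w => by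
    simp only [hν]
    rw [← map_sum, Finset.univ_sum_single]
  have hconst : ∀ u, inner ℝ (∑ i, ν i) u = (0 : ℝ) := fun u => by
    set cy : Fin (k + 1) → Euc ℓ := fun _ => y
    set cu : Fin (k + 1) → Euc ℓ := fun _ => u
    have hd : HasDerivAt (fun t : ℝ => cy + t • cu) cu 0 := by
      simpa using ((hasDerivAt_id (0 : ℝ)).smul_const cu).const_add cy
    have h1 := deriv_mem_tangentSpaceOf (J := 𝓘(ℝ, Fin (k + 1) → Euc ℓ))
      (W := diagonalSet (Euc ℓ) (k + 1)) (y := multiMap (k + 1) g q)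
      (c := fun t : ℝ => cy + t • cu) (by fun_prop)
      (by rw [extChartAt_model_space_eq_id]; simpa using hy)
      (Filter.Eventually.of_forall fun t => ⟨y + t • u, rfl⟩)
    rw [hd.deriv] at h1
    have h2 : f' cu = 0 := hf (Submodule.mem_sup_right h1)
    rw [hsingle] at h2
    rw [sum_inner]
    exact h2
  have hsum : ∑ i, ν i = 0 := by
    have := hconst (∑ i, ν i)
    exact inner_self_eq_zero.1 this
  have hder : ∀ i (v : Euc n), inner ℝ (ν i) (mfderiv (𝓡 n) (𝓡 ℓ) g (q.1 i) v : Euc ℓ) = 0 := by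
    intro i v
    have h1 : f' (fun j => mfderiv (𝓡 n) (𝓡 ℓ) g (q.1 j) ((Pi.single i v : Fin (k + 1) → Euc n) j))
        = 0 := by
      rw [← mfderiv_multiMap_apply hg q]
      exact hf (Submodule.mem_sup_left (LinearMap.mem_range_self _ _))
    replace h1 := (hsingle _).symm.trans h1
    rw [Finset.sum_eq_single i] at h1
    · simpa using h1
    · intro j _ hj
      rw [Pi.single_eq_of_ne hj]
      exact (congrArg (inner ℝ (ν j)) (map_zero (mfderiv (𝓡 n) (𝓡 ℓ) g (q.1 j)))).trans
        (inner_zero_right _)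
    · simp
  rw [Fin.sum_univ_succ] at hsum
  refine ⟨fun i => ν i.succ, fun (h0 : (fun i : Fin k => ν i.succ) = 0) => hf0 ?_, fun i v => hder _ v, fun v => ?_⟩
  · have h1 : ∀ i : Fin k, ν i.succ = 0 := fun i => congrFun h0 i
    have h2 : ν 0 = 0 := by simpa [h1] using hsum
    refine LinearMap.ext fun w => (hsingle w).trans ?_
    simp [Fin.sum_univ_succ, h1, h2]
    rfl
  · have h1 : ∑ i : Fin k, ν i.succ = -ν 0 := by
      rw [← add_eq_zero_iff_eq_neg, add_comm]; exact hsum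
    rw [h1]
    exact (inner_neg_left (ν 0) _).trans (neg_eq_zero.2 (hder 0 v))

end MultiMap

/-! ### General position -/

theorem infinite_of_chartedSpace_euclidean {n : ℕ} (hn : 0 < n) {N : Type*} [TopologicalSpace N]
    [ChartedSpace (Euc n) N] (q : N) : Infinite N := by
  have : Nonempty (Fin n) := ⟨⟨0, hn⟩⟩
  have h1 : ((chartAt (Euc n) q).target).Infinite :=
    infinite_of_mem_nhds _ (chart_target_mem_nhds (Euc n) q)
  have h2 : ((chartAt (Euc n) q).source).Infinite := by
    rw [← (chartAt (Euc n) q).symm_image_target_eq_source]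
    exact h1.image (chartAt (Euc n) q).symm.injOn
  exact h2.to_subtype.of_injective _ Subtype.val_injective

theorem exists_injective_extension {N : Type*} [Infinite N] {s S : ℕ} (h : s ≤ S) {q : Fin s → N}
    (hq : Function.Injective q) :
    ∃ r : Fin S → N, Function.Injective r ∧ ∀ i, r (Fin.castLE h i) = q i := by
  set e := (finite_range q).infinite_compl.natEmbedding
  refine ⟨fun i => if hi : (i : ℕ) < s then q ⟨i, hi⟩ else (e i : N), fun i j hij => ?_, fun i => ?_⟩
  · have hne : ∀ (a : Fin s) (b : ℕ), q a ≠ e b := fun a b hab => (e b).2 ⟨a, hab⟩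
    by_cases hi : (i : ℕ) < s <;> by_cases hj : (j : ℕ) < s <;> simp only [hi, hj, dite_true, dite_false] at hij
    · exact Fin.ext (Fin.mk.inj_iff.1 (hq hij))
    · exact (hne _ _ hij).elim
    · exact (hne _ _ hij.symm).elim
    · exact Fin.ext (e.injective (Subtype.ext hij))
  · simp

/-- Tuples of at most `s_f` distinct points are mapped by `f` to points in general position, since
they extend to tuples of `s_f` distinct points. -/
theorem linearIndependent_of_le_maxGeneralPosition {N : Type*} [Infinite N] {m k : ℕ}
    {f : N → Euc m} (hk : k + 1 ≤ maxGeneralPosition f) {q : Fin (k + 1) → N}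
    (hq : Function.Injective q) :
    LinearIndependent ℝ fun i : Fin k => f (q i.succ) - f (q 0) := by
  -- a set of natural numbers whose supremum is not `0` is nonempty and bounded
  have hmem : maxGeneralPosition f ∈ generalPositionNumbers f := by
    have hne : sSup (generalPositionNumbers f) ≠ 0 := by
      have : sSup (generalPositionNumbers f) = maxGeneralPosition f := rfl
      omega
    refine Nat.sSup_mem ?_ ?_
    · by_contra h
      rw [not_nonempty_iff_eq_empty] at h
      exact hne (by simp [h])
    · by_contra h
      exact hne (Nat.sSup_of_not_bddAbove h)
  obtain ⟨K, hK⟩ : ∃ K, maxGeneralPosition f = K + 1 := ⟨maxGeneralPosition f - 1, by omega⟩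
  rw [hK] at hmem hk
  obtain ⟨hpos, hspan⟩ := hmem
  obtain ⟨r, hr, hrq⟩ := exists_injective_extension hk hq
  have h1 := hspan r fun i j hij h => hij (hr h)
  have h2 : LinearIndependent ℝ fun i : Fin K => f (r i.succ) - f (r 0) := by
    rw [linearIndependent_iff_card_eq_finrank_span, Fintype.card_fin, Set.finrank]
    rw [show (⟨0, hpos⟩ : Fin (K + 1)) = 0 from rfl, Nat.add_sub_cancel] at h1
    have hset : (range fun i : Fin (K + 1) => f (r i) - f (r 0)) =
        insert 0 (range fun i : Fin K => f (r i.succ) - f (r 0)) := by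
      rw [Fin.range_fin_succ]
      simp
      rfl
    rw [hset, Submodule.span_insert_zero] at h1
    exact h1.symm
  have h3 := h2.comp (Fin.castLE (Nat.succ_le_succ_iff.1 hk)) (Fin.castLE_injective _)
  convert h3 using 1
  ext1 i
  rw [← hrq, ← hrq]
  rfl

theorem ae_multiTransverse {n m ℓ : ℕ} (hn : 0 < n) {N : Type*} [TopologicalSpace N] [T2Space N]
    [SecondCountableTopology N] [ChartedSpace (Euc n) N] [IsManifold (𝓡 n) ∞ N] {f : N → Euc m}
    {A : Matrix (Fin ℓ) (Fin m) ℝ} (hA : ∀ i j, A i j ≠ 0) (hf : ContMDiff (𝓡 n) (𝓡 m) ∞ f) :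
    ∀ᵐ p : Fin ℓ → Euc m, ∀ s : ℕ, 2 ≤ s → s ≤ maxGeneralPosition f →
      MultiTransverse (n := n) (genDistSq p A ∘ f) s := by
  obtain ⟨t, htc, ht⟩ := TopologicalSpace.countable_cover_nhds
    (fun q : N => extChartAt_source_mem_nhds (I := 𝓡 n) q)
  have : Countable t := htc.to_subtype
  -- tuples are covered by countably many products of chart domains
  have hae : ∀ᵐ p : Fin ℓ → Euc m, ∀ k : ℕ, ∀ c : Fin (k + 1) → t, _ := ae_all_iff.2 fun k =>
    ae_all_iff.2 fun c => ae_covector_eq_zero hA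
      (F := fun i => f ∘ (extChartAt (𝓡 n) (c i : N)).symm)
      (O := fun i => (extChartAt (𝓡 n) (c i : N)).target)
      (fun i => isOpen_extChartAt_target _) (fun i => contDiffOn_comp_extChartAt_symm hf _)
  filter_upwards [hae] with p hp s hs hsf q
  obtain ⟨k, rfl⟩ : ∃ k, s = k + 1 := ⟨s - 1, by omega⟩
  have hg : ContMDiff (𝓡 n) (𝓡 ℓ) ∞ (genDistSq p A ∘ f) :=
    (contDiff_genDistSq p A).contMDiff.comp hf
  by_contra H
  obtain ⟨hval, μ, hμ0, hμ, hμsum⟩ := exists_covector_of_not_transverse hg H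
  have hc : ∀ i, ∃ c : t, q.1 i ∈ (extChartAt (𝓡 n) (c : N)).source := fun i => by
    obtain ⟨c, hct, hc⟩ := mem_iUnion₂.1 (ht.symm ▸ mem_univ (q.1 i))
    exact ⟨⟨c, hct⟩, hc⟩
  choose c hc using hc
  have hinv : ∀ i, (extChartAt (𝓡 n) (c i : N)).symm (extChartAt (𝓡 n) (c i : N) (q.1 i)) = q.1 i :=
    fun i => (extChartAt (𝓡 n) (c i : N)).left_inv (hc i)
  have := infinite_of_chartedSpace_euclidean hn (q.1 0)
  refine hμ0 (hp k c (fun i => extChartAt (𝓡 n) (c i : N) (q.1 i))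
    (fun i => (extChartAt (𝓡 n) (c i : N)).map_source (hc i)) ?_ (fun i => ?_) μ (fun i v => ?_)
    fun v => ?_)
  · simp only [Function.comp_apply, hinv]
    exact linearIndependent_of_le_maxGeneralPosition hsf fun i j hij => by
      by_contra hne
      exact q.2 i j hne hij
  · simp only [Function.comp_apply, hinv]
    exact hval i
  · have := fderiv_comp_extChartAt_symm hg (hc i.succ)
    rw [← Function.comp_assoc, this]
    exact hμ i _
  · have := fderiv_comp_extChartAt_symm hg (hc 0)
    rw [← Function.comp_assoc, this]
    exact hμsum _

/-- If the fibres of `G` have at most `S` points and `f` is injective, then `G ∘ f` never maps more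
than `S` distinct points to a single one: the transversality condition is vacuous. -/
theorem multiTransverse_of_encard_le {n m ℓ : ℕ} {N : Type*} [TopologicalSpace N] [T2Space N]
    [ChartedSpace (Euc n) N] {f : N → Euc m} (hf : Function.Injective f) {G : Euc m → Euc ℓ}
    {S s : ℕ} (hG : ∀ y, (G ⁻¹' {y}).encard ≤ S) (hs : S < s) :
    MultiTransverse (n := n) (G ∘ f) s := by
  rintro q ⟨y, hy⟩
  have hinj : Function.Injective fun i => f (q.1 i) := fun i j hij => by
    by_contra hne
    exact q.2 i j hne (hf hij)
  have hsub : range (fun i => f (q.1 i)) ⊆ G ⁻¹' {y} := by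
    rintro _ ⟨i, rfl⟩
    exact (congrFun hy i).symm
  have h1 := (encard_le_encard hsub).trans (hG y)
  rw [← image_univ, hinj.encard_image, encard_univ] at h1
  simp at h1
  exact absurd hs (by exact_mod_cast h1.not_gt)

theorem proposition6p1 (n m ℓ : ℕ) (hn : 0 < n) (hm : 0 < m) (hℓ : 0 < ℓ)
    (N : Type*) [TopologicalSpace N] [T2Space N] [SecondCountableTopology N]
    [ChartedSpace (EuclideanSpace ℝ (Fin n)) N] [IsManifold (𝓡 n) ∞ N]
    (f : N → EuclideanSpace ℝ (Fin m))
    (A : Matrix (Fin ℓ) (Fin m) ℝ) (hA : ∀ i j, A i j ≠ 0) :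
    (IsSmoothImmersion (𝓡 n) (𝓡 m) f →
      ∀ X : Set (JetFiber n ℓ), IsSubmanifold X → IsA1Invariant X →
        ∃ S : Set (Fin ℓ → EuclideanSpace ℝ (Fin m)), volume S = 0 ∧
          ∀ p ∉ S, IsTransverse (𝓡 n) (jetModel n ℓ)
            (jet1 (genDistSq p A ∘ f)) (jetSubbundle X : Set (JetBundle n ℓ N))) ∧
    (ContMDiff (𝓡 n) (𝓡 m) ∞ f → Function.Injective f →
      ∃ S : Set (Fin ℓ → EuclideanSpace ℝ (Fin m)), volume S = 0 ∧
        ∀ p ∉ S,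
          (∀ s : ℕ, 2 ≤ s → s ≤ maxGeneralPosition f →
            MultiTransverse (n := n) (genDistSq p A ∘ f) s) ∧
          ((∀ y : EuclideanSpace ℝ (Fin ℓ),
              (genDistSq p A ⁻¹' {y}).encard ≤ maxGeneralPosition f) →
            HasNormalCrossings (n := n) (genDistSq p A ∘ f))) := by
  refine ⟨fun hf X _ hX => ⟨_, ae_isTransverse_jet1 (N := N) hA hf, fun p hp => ?_⟩,
    fun hf hinj => ⟨_, ae_multiTransverse hn hA hf, fun p hp => ?_⟩⟩
  · simp only [mem_compl_iff, mem_ofPred_eq, not_not] at hp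
    exact hp X hX
  · simp only [mem_compl_iff, mem_ofPred_eq, not_not] at hp
    refine ⟨hp, fun hG s hs => ?_⟩
    rcases le_or_gt s (maxGeneralPosition f) with h | h
    · exact hp s hs h
    · exact multiTransverse_of_encard_le hinj hG h
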